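/- Let $p$ be a prime. All groups below are Polish abelian groups (abelian topological groups whose topology is Polish), and morphisms are continuous homomorphisms. An abelian Lie group is one isomorphic to $\mathbb{R}^n\oplus\mathbb{T}^d\oplus D$ with $n,d\in\mathbb{N}$ and $D$ countable discrete. A closed subgroup $N$ of $G$ is co-Lie if $G/N$ is a Lie group, and $G$ is pro-Lie if every zero neighbourhood contains a co-Lie closed subgroup. $G$ is pro-$p$ if it is pro-Lie and every co-Lie closed subgroup $M$ contains a co-Lie closed subgroup $N$ such that $p^n x\to 0$ for every $x\in G/N$. Let $\mathbf{PAb}(p)$ be the category of pro-$p$ Polish abelian groups. A short exact sequence $A\to B\to C$ is an algebraically exact one in which $A\to B$ is a closed embedding and $B\to C$ is an open surjection. An object $G$ of $\mathbf{PAb}(p)$ is injective if for every short exact sequence $A\to B\to C$ in $\mathbf{PAb}(p)$ every morphism $A\to G$ extends to $B$. $\mathrm{Ext}(C,A)$ is the group of isomorphism classes of extensions (short exact sequences) $A\to X\to C$ of Polish abelian groups, whose zero element is the class of the split extension. $\mathbb{Z}(p^\infty)$ is the Prüfer group and $\mathbb{Z}(p^\infty)^{(\omega)}$ is the direct sum of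 countably infinitely many copies of it, both with the discrete topology; powers carry the product topology. Theorem. For a pro-$p$ Polish abelian group $G$, the following assertions are equivalent: (i) $G$ is injective in $\mathbf{PAb}(p)$; (ii) $G$ is divisible and has a basis of zero neighbourhoods consisting of divisible subgroups; (iii) $G\cong \mathbb{Z}(p^\infty)^{\alpha}\oplus\bigl(\mathbb{Z}(p^\infty)^{(\omega)}\bigr)^{\beta}$ (as topological groups) for some $\alpha,\beta\le\omega$; (iv) $\mathrm{Ext}\bigl((\mathbb{Z}(p^\infty)^{(\omega)})^{\omega},G\bigr)=0$. -/

import Mathlib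

open Topology Filter

universe u v

namespace ProPPolish

/-! ### Pro-Lie and pro-`p` Polish abelian groups -/

/-- An abelian Lie group (in the Polish setting): a topological group isomorphic to
`ℝⁿ ⊕ 𝕋ᵈ ⊕ D` with `n, d` natural numbers and `D` a countable discrete abelian group. -/
def IsLieAb (G : Type u) [AddCommGroup G] [TopologicalSpace G] : Prop :=
  ∃ (n d : ℕ) (D : Type) (_ : AddCommGroup D) (_ : TopologicalSpace D)
    (_ : DiscreteTopology D) (_ : Countable D),
    Nonempty (G ≃ₜ+ ((Fin n → ℝ) × (Fin d → UnitAddCircle) × D))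

/-- The collection of co-Lie closed subgroups of `G`. -/
def coLie (G : Type u) [AddCommGroup G] [TopologicalSpace G] : Set (AddSubgroup G) :=
  {N | IsClosed (N : Set G) ∧ IsLieAb (G ⧸ N)}

/-- `G` is pro-Lie: every zero neighbourhood contains a co-Lie closed subgroup. -/
def IsProLie (G : Type u) [AddCommGroup G] [TopologicalSpace G] : Prop :=
  ∀ U ∈ 𝓝 (0 : G), ∃ N ∈ coLie G, (N : Set G) ⊆ U

/-- `pⁿ x → 0` for every element `x`; for a locally compact Polish abelian group this says that
it is a topological `p`-group. -/
def PPowersVanish (p : ℕ) (G : Type u) [AddCommGroup G] [TopologicalSpace G] : Prop :=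
  ∀ x : G, Tendsto (fun n : ℕ => p ^ n • x) atTop (𝓝 0)

/-- A pro-`p` group: a pro-Lie group `G` that is a topological `p`-group, i.e. the co-Lie closed
subgroups `N` for which the (locally compact) Lie group `G / N` is a topological `p`-group are
cofinal among all co-Lie closed subgroups, ordered by reverse inclusion. -/
structure IsProP (p : ℕ) (G : Type u) [AddCommGroup G] [TopologicalSpace G] : Prop where
  proLie : IsProLie G
  cofinal : ∀ M ∈ coLie G, ∃ N ∈ coLie G, N ≤ M ∧ PPowersVanish p (G ⧸ N)

/-! ### Short exact sequences and injective objects -/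

/-- `A → B → C` is a short exact sequence of topological abelian groups: `f` is (an isomorphism
onto) the kernel of `g`, topologically, and `g` is a quotient map of topological groups. -/
structure IsShortExact {A B C : Type*} [AddCommGroup A] [TopologicalSpace A]
    [AddCommGroup B] [TopologicalSpace B] [AddCommGroup C] [TopologicalSpace C]
    (f : A →ₜ+ B) (g : B →ₜ+ C) : Prop where
  isClosedEmbedding : IsClosedEmbedding f
  exact : Function.Exact f g
  isOpenQuotientMap : IsOpenQuotientMap g

/-- `G` is injective in the category of pro-`p` Polish abelian groups and continuous
homomorphisms: for every short exact sequence `A → B → C` in this category, every morphism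
`A → G` extends along `A → B`. -/
def IsInjectiveInPAb (p : ℕ) (G : Type u) [AddCommGroup G] [TopologicalSpace G] : Prop :=
  ∀ (A B C : Type u)
    [AddCommGroup A] [TopologicalSpace A] [IsTopologicalAddGroup A] [PolishSpace A]
    [AddCommGroup B] [TopologicalSpace B] [IsTopologicalAddGroup B] [PolishSpace B]
    [AddCommGroup C] [TopologicalSpace C] [IsTopologicalAddGroup C] [PolishSpace C],
    IsProP p A → IsProP p B → IsProP p C →
    ∀ (f : A →ₜ+ B) (g : B →ₜ+ C), IsShortExact f g →
    ∀ φ : A →ₜ+ G, ∃ ψ : B →ₜ+ G, ψ.comp f = φ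

/-! ### `Ext` as the set of isomorphism classes of extensions -/

/-- An extension `A → X → C` of `C` by `A` in the category of Polish abelian groups. -/
structure PolishExtension (C : Type v) (A : Type u) [AddCommGroup C] [TopologicalSpace C]
    [AddCommGroup A] [TopologicalSpace A] where
  X : Type (max u v)
  [addCommGroup : AddCommGroup X]
  [topologicalSpace : TopologicalSpace X]
  [isTopologicalAddGroup : IsTopologicalAddGroup X]
  [polishSpace : PolishSpace X]
  incl : A →ₜ+ X
  proj : X →ₜ+ C
  isShortExact : IsShortExact incl proj

attribute [instance] PolishExtension.addCommGroup PolishExtension.topologicalSpace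
  PolishExtension.isTopologicalAddGroup PolishExtension.polishSpace

section Ext

variable (C : Type v) (A : Type u) [AddCommGroup C] [TopologicalSpace C]
  [AddCommGroup A] [TopologicalSpace A]

/-- Isomorphism of extensions: an isomorphism of topological groups between the middle terms
that is compatible with the maps from `A` and to `C`. -/
def PolishExtension.Iso {C : Type v} {A : Type u} [AddCommGroup C] [TopologicalSpace C]
    [AddCommGroup A] [TopologicalSpace A] (E F : PolishExtension C A) : Prop :=
  ∃ e : E.X ≃ₜ+ F.X, (∀ a, e (E.incl a) = F.incl a) ∧ (∀ x, F.proj (e x) = E.proj x)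

instance PolishExtension.setoid : Setoid (PolishExtension C A) where
  r := PolishExtension.Iso
  iseqv :=
    { refl := fun E => ⟨ContinuousAddEquiv.refl E.X, fun _ => rfl, fun _ => rfl⟩
      symm := by
        rintro E F ⟨e, h₁, h₂⟩
        refine ⟨e.symm, fun a => ?_, fun x => ?_⟩
        · rw [← h₁ a]; exact e.toEquiv.symm_apply_apply _
        · rw [← h₂]; exact congrArg F.proj (e.toEquiv.apply_symm_apply x)
      trans := by
        rintro E F H ⟨e, h₁, h₂⟩ ⟨e', h₁', h₂'⟩
        refine ⟨e.trans e', fun a => ?_, fun x => ?_⟩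
        · exact (congrArg e' (h₁ a)).trans (h₁' a)
        · exact (h₂' (e x)).trans (h₂ x) }

/-- The underlying set of the Yoneda group `Ext(C, A)`: isomorphism classes of extensions
`A → X → C` of Polish abelian groups. -/
def Ext : Type _ := Quotient (PolishExtension.setoid C A)

variable [IsTopologicalAddGroup C] [PolishSpace C] [IsTopologicalAddGroup A] [PolishSpace A]

/-- The split extension `A → A ⊕ C → C`. -/
def PolishExtension.split : PolishExtension C A where
  X := A × C
  incl := ContinuousAddMonoidHom.inl A C
  proj := ContinuousAddMonoidHom.snd A C
  isShortExact :=
    { isClosedEmbedding := by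
        refine IsClosedEmbedding.of_continuous_injective_isClosedMap
          (ContinuousAddMonoidHom.inl A C).continuous_toFun
          (fun a b h => congrArg Prod.fst h) ?_
        intro s hs
        have : (ContinuousAddMonoidHom.inl A C) '' s = s ×ˢ ({0} : Set C) := by
          ext ⟨a, c⟩
          constructor
          · rintro ⟨b, hb, h⟩
            have h₁ : b = a := congrArg Prod.fst h
            have h₂ : (0 : C) = c := congrArg Prod.snd h
            exact ⟨h₁ ▸ hb, h₂.symm⟩
          · rintro ⟨ha, hc⟩
            exact ⟨a, ha, Prod.ext rfl (Eq.symm hc)⟩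
        rw [this]
        exact hs.prod isClosed_singleton
      exact := by
        rintro ⟨a, c⟩
        constructor
        · intro h
          exact ⟨a, Prod.ext rfl (Eq.symm h)⟩
        · rintro ⟨b, hb⟩
          exact (congrArg Prod.snd hb).symm
      isOpenQuotientMap := ⟨Prod.snd_surjective, continuous_snd, isOpenMap_snd⟩ }

/-- The zero element of `Ext(C, A)` is the class of the split extension. -/
instance Ext.instZero : Zero (Ext C A) :=
  ⟨Quotient.mk (PolishExtension.setoid C A) (PolishExtension.split C A)⟩

end Ext

/-! ### The groups `ℤ(p^∞)` and `ℤ(p^∞)^(ω)` -/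

/-- The elements of `p`-power order in `ℚ / ℤ`. -/
def pruferSubgroup (p : ℕ) : AddSubgroup (ℚ ⧸ AddSubgroup.zmultiples (1 : ℚ)) where
  carrier := {x | ∃ n : ℕ, p ^ n • x = 0}
  zero_mem' := ⟨0, smul_zero _⟩
  add_mem' := by
    rintro x y ⟨m, hm⟩ ⟨n, hn⟩
    refine ⟨m + n, ?_⟩
    rw [smul_add, pow_add, mul_smul, mul_smul, hn, smul_zero, add_zero, smul_comm, hm, smul_zero]
  neg_mem' := by
    rintro x ⟨n, hn⟩
    exact ⟨n, by rw [smul_neg, hn, neg_zero]⟩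

/-- The Prüfer group `ℤ(p^∞)`, with the discrete topology. -/
def Prufer (p : ℕ) : Type := pruferSubgroup p

instance (p : ℕ) : AddCommGroup (Prufer p) := inferInstanceAs (AddCommGroup (pruferSubgroup p))
instance (p : ℕ) : Countable (Prufer p) :=
  have : Countable (ℚ ⧸ AddSubgroup.zmultiples (1 : ℚ)) := Quotient.countable
  inferInstanceAs (Countable (pruferSubgroup p))
instance (p : ℕ) : TopologicalSpace (Prufer p) := ⊥
instance (p : ℕ) : DiscreteTopology (Prufer p) := ⟨rfl⟩
instance (p : ℕ) : PolishSpace (Prufer p) := inferInstance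

/-- The direct sum `ℤ(p^∞)^(ω)` of countably many copies of the Prüfer group, with the discrete
topology. -/
def PruferSum (p : ℕ) : Type := ℕ →₀ Prufer p

noncomputable instance (p : ℕ) : AddCommGroup (PruferSum p) :=
  inferInstanceAs (AddCommGroup (ℕ →₀ Prufer p))
instance (p : ℕ) : Countable (PruferSum p) := inferInstanceAs (Countable (ℕ →₀ Prufer p))
instance (p : ℕ) : TopologicalSpace (PruferSum p) := ⊥
instance (p : ℕ) : DiscreteTopology (PruferSum p) := ⟨rfl⟩
instance (p : ℕ) : PolishSpace (PruferSum p) := inferInstance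

/-- The set of natural numbers below `α ≤ ω`, so that functions on it form an `α`-th power. -/
abbrev Below (α : ℕ∞) : Type := {n : ℕ // (n : ℕ∞) < α}

end ProPPolish

/-! The pro-`p` condition amounts to a concrete one, `HasOpenPBasis`: zero has a basis of open
subgroups with `p`-torsion quotient. This holds because a Lie group in which `p`-powers tend to zero
is discrete. Condition (ii) is the hub to which the other three are compared.

From (ii), choose a decreasing basis of open divisible subgroups `V n` with `V 0 = G`. Each quotient
map `V n → V n / V (n + 1)` extends to `G` by divisibility of its target. Together these extensions
identify `G` with the product of the countable discrete divisible `p`-torsion groups `V n / V (n +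
1)`; completeness of Polish groups gives surjectivity. Each factor is a direct sum of Prüfer groups,
which gives (iii). A discrete divisible group receives extensions of maps along `A → B` whenever `B
/ A` is nonarchimedean, because an open subgroup of the kernel contains the trace of an open
subgroup of `B`. Arguing coordinatewise yields (i), and also (iv), where nothing is known in advance
about the middle term.

Conversely, every pro-`p` group is a closed subgroup of `P = (ℤ(p^∞)^(ω))^ω`, and (ii) passes from
`P` to its retracts. Injectivity extends the identity of `G` to a retraction of `P`. Under (iv), the
quotient `Q = P / G` inherits (ii) from `P`, so it is itself a retract of `P`. Vanishing of `Ext`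
lifts the retraction `P → Q` along the quotient map, and restricting the lift to `Q` splits `P → Q`.
-/

namespace ProPPolish

/-! ### Divisible groups and `p`-torsion groups -/

/-- Every element can be divided by every nonzero natural number. -/
def IsDivisible (D : Type*) [AddCommGroup D] : Prop :=
  ∀ n : ℕ, n ≠ 0 → ∀ x : D, ∃ y : D, n • y = x

/-- Every element is killed by a power of `p`. -/
def IsPTorsion (p : ℕ) (D : Type*) [AddCommGroup D] : Prop :=
  ∀ x : D, ∃ n : ℕ, p ^ n • x = 0

section Algebra

variable {D E : Type*} [AddCommGroup D] [AddCommGroup E]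

theorem nonempty_divisibleBy_iff : Nonempty (DivisibleBy D ℕ) ↔ IsDivisible D := by
  constructor
  · rintro ⟨h⟩ n hn x
    exact ⟨DivisibleBy.div x n, DivisibleBy.div_cancel x hn⟩
  · intro h
    classical
    exact ⟨{ div := fun x n => if hn : n = 0 then 0 else (h n hn x).choose
             div_zero := fun x => by simp
             div_cancel := fun {n} x hn => by
              simpa [hn] using (h n hn x).choose_spec }⟩

theorem IsDivisible.of_surjective (h : IsDivisible D) (f : D →+ E)
    (hf : Function.Surjective f) : IsDivisible E := by
  intro n hn x
  obtain ⟨z, rfl⟩ := hf x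
  obtain ⟨y, rfl⟩ := h n hn z
  exact ⟨f y, (map_nsmul f n y).symm⟩

theorem IsDivisible.pi {ι : Type*} {D : ι → Type*} [∀ i, AddCommGroup (D i)]
    (h : ∀ i, IsDivisible (D i)) : IsDivisible (∀ i, D i) := by
  intro n hn x
  choose y hy using fun i => h i n hn (x i)
  exact ⟨y, funext hy⟩

theorem IsDivisible.prod (hD : IsDivisible D) (hE : IsDivisible E) : IsDivisible (D × E) := by
  intro n hn x
  obtain ⟨y, hy⟩ := hD n hn x.1
  obtain ⟨z, hz⟩ := hE n hn x.2
  exact ⟨(y, z), Prod.ext hy hz⟩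

theorem IsDivisible.finsupp {ι : Type*} (hD : IsDivisible D) : IsDivisible (ι →₀ D) := by
  intro n hn x
  choose y hy using hD n hn
  induction x using Finsupp.induction_linear with
  | zero => exact ⟨0, smul_zero _⟩
  | add f g hf hg =>
    obtain ⟨a, rfl⟩ := hf
    obtain ⟨b, rfl⟩ := hg
    exact ⟨a + b, smul_add _ _ _⟩
  | single i d => exact ⟨Finsupp.single i (y d), by rw [Finsupp.smul_single, hy]⟩

theorem IsPTorsion.finsupp {p : ℕ} {ι : Type*} (hD : IsPTorsion p D) :
    IsPTorsion p (ι →₀ D) := by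
  intro x
  induction x using Finsupp.induction_linear with
  | zero => exact ⟨0, smul_zero _⟩
  | add f g hf hg =>
    obtain ⟨m, hm⟩ := hf
    obtain ⟨n, hn⟩ := hg
    refine ⟨m + n, ?_⟩
    rw [smul_add, pow_add, mul_smul, mul_smul, hn, smul_zero, add_zero, smul_comm, hm, smul_zero]
  | single i d =>
    obtain ⟨n, hn⟩ := hD d
    exact ⟨n, by rw [Finsupp.smul_single, hn, Finsupp.single_zero]⟩

/-- A `p`-torsion group that is divisible by `p` is divisible. -/
theorem IsPTorsion.isDivisible {p : ℕ} (hp : p.Prime) (h : IsPTorsion p D)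
    (hdiv : ∀ x : D, ∃ y : D, p • y = x) : IsDivisible D := by
  have hpow : ∀ (k : ℕ) (x : D), ∃ y : D, p ^ k • y = x := by
    intro k
    induction k with
    | zero => exact fun x => ⟨x, by simp⟩
    | succ k ih =>
      intro x
      obtain ⟨y, rfl⟩ := ih x
      obtain ⟨z, rfl⟩ := hdiv y
      exact ⟨z, by rw [pow_succ, mul_smul]⟩
  -- Multiplication by `m` is invertible on the `p ^ k`-torsion; the Bézout coefficient provides the
  -- inverse.
  have hcop : ∀ m : ℕ, Nat.Coprime m p → ∀ x : D, ∃ y : D, m • y = x := by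
    intro m hm x
    obtain ⟨k, hk⟩ := h x
    have hb := Nat.gcd_eq_gcd_ab m (p ^ k)
    rw [(hm.pow_right k : Nat.gcd m (p ^ k) = 1)] at hb
    refine ⟨(Nat.gcdA m (p ^ k)) • x, ?_⟩
    have h1 : ((1 : ℕ) : ℤ) • x = x := by simp
    rw [hb, add_smul, mul_smul, mul_comm, mul_smul, natCast_zsmul, natCast_zsmul, hk, smul_zero,
      add_zero] at h1
    exact h1
  intro n hn x
  obtain ⟨k, m, hm, rfl⟩ := Nat.exists_eq_pow_mul_and_not_dvd hn p hp.ne_one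
  obtain ⟨y, rfl⟩ := hpow k x
  obtain ⟨z, rfl⟩ := hcop m ((Nat.Prime.coprime_iff_not_dvd hp).2 hm).symm y
  exact ⟨z, mul_smul _ _ _⟩

/-- Homomorphisms into divisible groups extend. -/
theorem IsDivisible.exists_extension (hD : IsDivisible D) {A Y : Type*} [AddCommGroup A]
    [AddCommGroup Y] (h : A →+ Y) (φ : A →+ D) (hker : ∀ a, h a = 0 → φ a = 0) :
    ∃ ψ : Y →+ D, ∀ a, ψ (h a) = φ a := by
  obtain ⟨inst⟩ := nonempty_divisibleBy_iff.2 hD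
  let _ : DivisibleBy D ℤ := AddGroup.divisibleByIntOfDivisibleByNat D
  have hle : h.ker ≤ φ.ker := fun a ha => hker a ha
  obtain ⟨ψ, hψ⟩ := (Module.Baer.of_divisible D).extension_property_addMonoidHom
    (QuotientAddGroup.kerLift h) (QuotientAddGroup.kerLift_injective h)
    (QuotientAddGroup.lift h.ker φ hle)
  refine ⟨ψ, fun a => ?_⟩
  have := DFunLike.congr_fun hψ (QuotientAddGroup.mk a)
  simpa using this

/-- A homomorphism on a `p`-torsion group is injective if it is so on the `p`-socle. -/
theorem IsPTorsion.injective_of_socle {p : ℕ} (h : IsPTorsion p D) (f : D →+ E)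
    (hf : ∀ x, p • x = 0 → f x = 0 → x = 0) : Function.Injective f := by
  rw [injective_iff_map_eq_zero]
  intro x hx
  obtain ⟨n, hn⟩ := h x
  induction n with
  | zero => simpa using hn
  | succ n ih =>
    refine ih (hf _ ?_ ?_)
    · rw [← mul_smul, ← pow_succ', hn]
    · rw [map_nsmul, hx, smul_zero]

end Algebra

/-! ### The Prüfer group -/

section Prufer

variable (p : ℕ)

theorem Prufer.isPTorsion : IsPTorsion p (Prufer p) := fun x => by
  obtain ⟨n, hn⟩ := x.2
  exact ⟨n, Subtype.ext hn⟩

theorem Prufer.isDivisible [Fact p.Prime] : IsDivisible (Prufer p) := by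
  refine (Prufer.isPTorsion p).isDivisible Fact.out ?_
  have hp : (p : ℚ) ≠ 0 := Nat.cast_ne_zero.2 (Fact.out : p.Prime).ne_zero
  rintro ⟨x, n, hn⟩
  obtain ⟨q, rfl⟩ := QuotientAddGroup.mk_surjective x
  have key : p • (QuotientAddGroup.mk (q / p) : ℚ ⧸ AddSubgroup.zmultiples (1 : ℚ)) =
      QuotientAddGroup.mk q := by
    rw [← QuotientAddGroup.mk_nsmul, nsmul_eq_mul, mul_div_cancel₀ _ hp]
  exact ⟨⟨QuotientAddGroup.mk (q / p), n + 1, by rw [pow_succ, mul_smul, key, hn]⟩,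
    Subtype.ext key⟩

/-- The `p`-socle of the Prüfer group is cyclic of order `p`. -/
theorem Prufer.exists_socle_generator [Fact p.Prime] :
    ∃ g : Prufer p, p • g = 0 ∧ g ≠ 0 ∧ ∀ x : Prufer p, p • x = 0 → ∃ c : ℤ, x = c • g := by
  have hprime : p.Prime := Fact.out
  have hp : (p : ℚ) ≠ 0 := Nat.cast_ne_zero.2 hprime.ne_zero
  have key : p • (QuotientAddGroup.mk ((1 : ℚ) / p) : ℚ ⧸ AddSubgroup.zmultiples (1 : ℚ)) = 0 := by
    rw [← QuotientAddGroup.mk_nsmul, nsmul_eq_mul, mul_div_cancel₀ _ hp]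
    exact (QuotientAddGroup.eq_zero_iff _).2 (AddSubgroup.mem_zmultiples _)
  refine ⟨⟨QuotientAddGroup.mk ((1 : ℚ) / p), 1, by rw [pow_one, key]⟩, Subtype.ext key, ?_, ?_⟩
  · intro h
    have h' := (QuotientAddGroup.eq_zero_iff _).1 (congrArg Subtype.val h)
    obtain ⟨k, hk⟩ := AddSubgroup.mem_zmultiples_iff.1 h'
    rw [zsmul_eq_mul, mul_one, eq_div_iff hp] at hk
    have hk' : k * (p : ℤ) = 1 := by exact_mod_cast hk
    have := Int.isUnit_iff.1 (IsUnit.of_mul_eq_one _ (by rw [mul_comm]; exact hk' : (p : ℤ) * k = 1))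
    have := hprime.two_le
    omega
  · rintro ⟨x, n, hn⟩ hx
    obtain ⟨q, rfl⟩ := QuotientAddGroup.mk_surjective x
    have h' : p • (QuotientAddGroup.mk q : ℚ ⧸ AddSubgroup.zmultiples (1 : ℚ)) = 0 :=
      congrArg Subtype.val hx
    rw [← QuotientAddGroup.mk_nsmul, QuotientAddGroup.eq_zero_iff] at h'
    obtain ⟨k, hk⟩ := AddSubgroup.mem_zmultiples_iff.1 h'
    rw [zsmul_eq_mul, mul_one, nsmul_eq_mul] at hk
    refine ⟨k, Subtype.ext ?_⟩
    change QuotientAddGroup.mk q = k • QuotientAddGroup.mk ((1 : ℚ) / p)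
    rw [← QuotientAddGroup.mk_zsmul, zsmul_eq_mul, hk, mul_one_div, mul_div_cancel_left₀ _ hp]

end Prufer

/-- The `p`-socle of a group. -/
def socle (p : ℕ) (D : Type*) [AddCommGroup D] : AddSubgroup D :=
  (nsmulAddMonoidHom p : D →+ D).ker

theorem mem_socle {p : ℕ} {D : Type*} [AddCommGroup D] {x : D} : x ∈ socle p D ↔ p • x = 0 :=
  Iff.rfl

/-- A countable `p`-torsion group embeds in a countable direct sum of Prüfer groups so that its
image contains the socle. -/
theorem IsPTorsion.exists_embedding {p : ℕ} [Fact p.Prime] {D : Type u} [AddCommGroup D]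
    [Countable D] (h : IsPTorsion p D) :
    ∃ (ι : Type u) (_ : Countable ι) (φ : D →+ (ι →₀ Prufer p)), Function.Injective φ ∧
      ∀ t, p • t = 0 → ∃ d, φ d = t := by
  classical
  let _ : Module (ZMod p) (socle p D) :=
    AddCommGroup.zmodModule (fun x => Subtype.ext (mem_socle.1 x.2))
  obtain ⟨ι, hι, ⟨b⟩⟩ : ∃ (ι : Type u) (_ : Countable ι),
      Nonempty (Module.Basis ι (ZMod p) (socle p D)) :=
    ⟨_, inferInstance, ⟨Module.Basis.ofVectorSpace (ZMod p) (socle p D)⟩⟩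
  obtain ⟨g, hg0, hg1, hg⟩ := Prufer.exists_socle_generator p
  let γ : ZMod p →+ Prufer p := ZMod.lift p ⟨zmultiplesHom _ g, by simpa using hg0⟩
  have hγ : ∀ c : ℤ, γ c = c • g := fun c => by simp [γ]
  have hγinj : Function.Injective γ := by
    rw [injective_iff_map_eq_zero]
    intro x hx
    obtain ⟨c, rfl⟩ := ZMod.intCast_surjective x
    rw [hγ] at hx
    rw [ZMod.intCast_zmod_eq_zero_iff_dvd]
    have h1 : (addOrderOf g : ℤ) ∣ c := addOrderOf_dvd_iff_zsmul_eq_zero.2 hx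
    rwa [addOrderOf_eq_prime hg0 hg1] at h1
  let s : socle p D →+ (ι →₀ Prufer p) :=
    (Finsupp.mapRange.addMonoidHom γ).comp b.repr.toLinearMap.toAddMonoidHom
  have hs : Function.Injective s :=
    (Finsupp.mapRange_injective γ (map_zero γ) hγinj).comp b.repr.injective
  -- The socle is an `𝔽_p`-space, embedded by `s` through a basis with one Prüfer group per basis
  -- vector. Any extension of `s` to `D` stays injective, since the socle meets every nonzero
  -- subgroup of a `p`-torsion group.
  obtain ⟨φ, hφ⟩ := ((Prufer.isDivisible p).finsupp (ι := ι)).exists_extension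
    (socle p D).subtype s (fun a ha => by
      rw [(Subtype.ext ha : a = 0), map_zero])
  refine ⟨ι, hι, φ, h.injective_of_socle φ ?_, ?_⟩
  · intro x hx hx0
    have := hφ ⟨x, hx⟩
    rw [AddSubgroup.subtype_apply, hx0] at this
    exact congrArg Subtype.val ((injective_iff_map_eq_zero s).1 hs _ this.symm)
  · intro t ht
    have hcoord : ∀ i, ∃ c : ZMod p, γ c = t i := fun i => by
      obtain ⟨c, hc⟩ := hg (t i) (by
        have := DFunLike.congr_fun ht i
        simpa using this)
      exact ⟨c, by rw [hγ, hc]⟩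
    choose c hc using hcoord
    let c' : ι →₀ ZMod p := Finsupp.onFinset t.support c (fun i hi => by
      rw [Finsupp.mem_support_iff]
      intro h0
      exact hi (hγinj (by rw [hc, h0, map_zero])))
    obtain ⟨d, hd⟩ := b.repr.surjective c'
    refine ⟨d, ?_⟩
    rw [← AddSubgroup.subtype_apply, hφ]
    ext1 i
    simp [s, hd, c', hc]

/-- A countable divisible `p`-torsion group is a direct sum of Prüfer groups. -/
theorem IsPTorsion.exists_addEquiv_finsupp {p : ℕ} [Fact p.Prime] {D : Type u} [AddCommGroup D]
    [Countable D] (h : IsPTorsion p D) (hD : IsDivisible D) :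
    ∃ (ι : Type u) (_ : Countable ι), Nonempty (D ≃+ (ι →₀ Prufer p)) := by
  obtain ⟨ι, hι, φ, hφ, hsoc⟩ := h.exists_embedding
  refine ⟨ι, hι, ⟨AddEquiv.ofBijective φ ⟨hφ, ?_⟩⟩⟩
  -- A left inverse `ψ` of `φ` exists because `D` is divisible. It is injective on the socle, which
  -- lies in the image of `φ`, hence injective; so `φ` is onto.
  obtain ⟨ψ, hψ⟩ := hD.exists_extension φ (AddMonoidHom.id D)
    (fun a ha => (injective_iff_map_eq_zero φ).1 hφ a ha)
  have hinj : Function.Injective ψ := by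
    refine ((Prufer.isPTorsion p).finsupp).injective_of_socle ψ ?_
    intro t ht h0
    obtain ⟨d, rfl⟩ := hsoc t ht
    rw [hψ] at h0
    rw [show d = 0 from h0, map_zero]
  exact fun t => ⟨ψ t, hinj (hψ _)⟩


/-! ### Completeness of Polish abelian groups -/

/-- A dense completely metrizable subspace of a Hausdorff space is a `Gδ` set. -/
theorem isGδ_range_of_isEmbedding {X Y : Type*} [TopologicalSpace X]
    [TopologicalSpace.IsCompletelyMetrizableSpace X]
    [TopologicalSpace Y] [T2Space Y] {f : X → Y} (hf : IsEmbedding f) (hd : DenseRange f) :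
    IsGδ (Set.range f) := by
  let _ := TopologicalSpace.upgradeIsCompletelyMetrizable X
  -- `O n` collects the points having a neighbourhood whose preimage has small diameter. At a point
  -- of every `O n` the preimages of neighbourhoods form a Cauchy filter, and its limit maps to that
  -- point.
  let O : ℕ → Set Y := fun n =>
    ⋃₀ {W | IsOpen W ∧ ∀ x y, f x ∈ W → f y ∈ W → dist x y < 1 / ((n : ℝ) + 1)}
  have hO : Set.range f = ⋂ n, O n := by
    refine Set.Subset.antisymm ?_ ?_
    · rintro _ ⟨x, rfl⟩
      refine Set.mem_iInter.2 fun n => ?_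
      have hr : (0 : ℝ) < 1 / ((n : ℝ) + 1) / 2 := by positivity
      obtain ⟨W, hW, hWb⟩ := hf.isInducing.isOpen_iff.1
        (Metric.isOpen_ball (x := x) (ε := 1 / ((n : ℝ) + 1) / 2))
      refine Set.mem_sUnion.2 ⟨W, ⟨hW, fun a b ha hb => ?_⟩, ?_⟩
      · have ha' : a ∈ Metric.ball x (1 / ((n : ℝ) + 1) / 2) := hWb ▸ ha
        have hb' : b ∈ Metric.ball x (1 / ((n : ℝ) + 1) / 2) := hWb ▸ hb
        have := dist_triangle_right a b x
        rw [Metric.mem_ball] at ha' hb'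
        linarith
      · have : x ∈ f ⁻¹' W := hWb ▸ Metric.mem_ball_self hr
        exact this
    · intro y hy
      have hne : (comap f (𝓝 y)).NeBot := comap_neBot fun t ht => by
        obtain ⟨_, hyt, a, rfl⟩ := mem_closure_iff_nhds.1 (hd y) t ht
        exact ⟨a, hyt⟩
      have hc : Cauchy (comap f (𝓝 y)) := by
        refine Metric.cauchy_iff.2 ⟨hne, fun ε hε => ?_⟩
        obtain ⟨n, hn⟩ := exists_nat_one_div_lt hε
        obtain ⟨W, ⟨hW, hWd⟩, hyW⟩ := Set.mem_sUnion.1 (Set.mem_iInter.1 hy n)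
        exact ⟨f ⁻¹' W, preimage_mem_comap (hW.mem_nhds hyW),
          fun a ha b hb => (hWd a b ha hb).trans hn⟩
      obtain ⟨x, hx⟩ := CompleteSpace.complete hc
      exact ⟨x, tendsto_nhds_unique ((hf.continuous.tendsto x).mono_left hx) tendsto_comap⟩
  rw [hO]
  exact IsGδ.iInter_of_isOpen fun n => isOpen_sUnion fun W hW => hW.1

/-- The given metric need not be the complete one. In the completion, `G` and each translate `G + y`
are dense `Gδ` sets, so they meet by Baire; thus `y` is a difference of elements of `G`. -/
theorem completeSpace_of_isCompletelyMetrizableSpace (G : Type*) [AddCommGroup G] [MetricSpace G]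
    [IsUniformAddGroup G] [TopologicalSpace.IsCompletelyMetrizableSpace G] : CompleteSpace G := by
  have hemb : IsEmbedding ((↑) : G → UniformSpace.Completion G) :=
    UniformSpace.Completion.isUniformEmbedding_coe G |>.isEmbedding
  have hdense : DenseRange ((↑) : G → UniformSpace.Completion G) :=
    UniformSpace.Completion.denseRange_coe
  have hG := isGδ_range_of_isEmbedding hemb hdense
  have hsurj : Function.Surjective ((↑) : G → UniformSpace.Completion G) := by
    intro y
    have hG' : IsGδ ((fun z => z - y) ⁻¹' Set.range ((↑) : G → UniformSpace.Completion G)) :=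
      hG.preimage (by fun_prop)
    have hd' : Dense ((fun z => z - y) ⁻¹' Set.range ((↑) : G → UniformSpace.Completion G)) :=
      Dense.preimage hdense (Homeomorph.subRight y).isOpenMap
    obtain ⟨z, ⟨a, ha⟩, b, hb⟩ := (Dense.inter_of_Gδ hG hG' hdense hd').nonempty
    refine ⟨a - b, ?_⟩
    rw [UniformSpace.Completion.coe_sub, ha, hb, sub_sub_cancel]
  have hcl : IsClosed (Set.range ((↑) : G → UniformSpace.Completion G)) := by
    rw [hsurj.range_eq]; exact isClosed_univ
  exact (UniformSpace.Completion.isUniformInducing_coe G).completeSpace hcl.isComplete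

/-- A Polish abelian group is complete in its group uniformity. -/
theorem completeSpace_rightUniformSpace (G : Type*) [AddCommGroup G] [TopologicalSpace G]
    [IsTopologicalAddGroup G] [PolishSpace G] :
    @CompleteSpace G (IsTopologicalAddGroup.rightUniformSpace G) := by
  let _ : UniformSpace G := IsTopologicalAddGroup.rightUniformSpace G
  have : IsUniformAddGroup G := isUniformAddGroup_of_addCommGroup
  have : (uniformity G).IsCountablyGenerated := IsUniformAddGroup.uniformity_countably_generated
  let _ : MetricSpace G := UniformSpace.metricSpace G
  exact completeSpace_of_isCompletelyMetrizableSpace G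

/-- The quotient of a Polish abelian group by a closed subgroup is Polish. -/
theorem polishSpace_quotient {G : Type*} [AddCommGroup G] [TopologicalSpace G]
    [IsTopologicalAddGroup G] [PolishSpace G] (N : AddSubgroup G) (hN : IsClosed (N : Set G)) :
    PolishSpace (G ⧸ N) := by
  have := completeSpace_rightUniformSpace G
  have hc := QuotientAddGroup.completeSpace_right' G N
  have : T1Space (G ⧸ N) := QuotientAddGroup.t1Space_iff.2 hN
  let _ : UniformSpace (G ⧸ N) := IsTopologicalAddGroup.rightUniformSpace (G ⧸ N)
  have : IsUniformAddGroup (G ⧸ N) := isUniformAddGroup_of_addCommGroup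
  have : SecondCountableTopology (G ⧸ N) :=
    QuotientAddGroup.isOpenQuotientMap_mk.isQuotientMap.secondCountableTopology
      QuotientAddGroup.isOpenQuotientMap_mk.isOpenMap
  have : (uniformity (G ⧸ N)).IsCountablyGenerated :=
    IsUniformAddGroup.uniformity_countably_generated
  have : T0Space (G ⧸ N) := inferInstance
  infer_instance

/-- A topological group embedding of a Polish abelian group in a Hausdorff group is closed. -/
theorem isClosedEmbedding_of_isInducing {G H : Type*} [AddCommGroup G] [TopologicalSpace G]
    [IsTopologicalAddGroup G] [PolishSpace G] [AddCommGroup H] [TopologicalSpace H]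
    [IsTopologicalAddGroup H] [T2Space H] (f : G →+ H) (hf : IsInducing f) :
    IsClosedEmbedding f := by
  have hc := completeSpace_rightUniformSpace G
  let _ : UniformSpace G := IsTopologicalAddGroup.rightUniformSpace G
  let _ : UniformSpace H := IsTopologicalAddGroup.rightUniformSpace H
  have : IsUniformAddGroup G := isUniformAddGroup_of_addCommGroup
  have : IsUniformAddGroup H := isUniformAddGroup_of_addCommGroup
  exact ((AddMonoidHom.isUniformInducing_of_isInducing hf).isUniformEmbedding).isClosedEmbedding


/-! ### Pro-`p` groups as groups with enough open subgroups -/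

/-- Every zero neighbourhood contains an open subgroup with `p`-torsion quotient. -/
def HasOpenPBasis (p : ℕ) (G : Type*) [AddCommGroup G] [TopologicalSpace G] : Prop :=
  ∀ U ∈ 𝓝 (0 : G), ∃ N : AddSubgroup G, IsOpen (N : Set G) ∧ (N : Set G) ⊆ U ∧
    ∀ x : G, ∃ n : ℕ, p ^ n • x ∈ N

theorem isLieAb_of_discrete (D : Type*) [AddCommGroup D] [TopologicalSpace D]
    [DiscreteTopology D] [Countable D] : IsLieAb D := by
  -- `IsLieAb` asks for a discrete factor in `Type`, so the countable group is moved there.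
  let _ : TopologicalSpace (Shrink.{0} D) := ⊥
  have : DiscreteTopology (Shrink.{0} D) := ⟨rfl⟩
  let e : D ≃+ Shrink.{0} D := Shrink.addEquiv.symm
  refine ⟨0, 0, Shrink.{0} D, inferInstance, inferInstance, inferInstance,
    (equivShrink.{0} D).symm.injective.countable,
    ⟨{ toFun := fun x => (0, 0, e x)
       invFun := fun y => e.symm y.2.2
       left_inv := fun x => e.symm_apply_apply x
       right_inv := fun y => Prod.ext (Subsingleton.elim _ _)
        (Prod.ext (Subsingleton.elim _ _) (e.apply_symm_apply _))
       map_add' := fun x y => Prod.ext (Subsingleton.elim _ _)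
        (Prod.ext (Subsingleton.elim _ _) (map_add e x y))
       continuous_toFun := continuous_of_discreteTopology
       continuous_invFun := (continuous_of_discreteTopology (f := e.symm)).comp
        (continuous_snd.comp continuous_snd) }⟩⟩

theorem discreteTopology_of_subsingleton {n d : ℕ} {D Q : Type*} [AddCommGroup D]
    [TopologicalSpace D] [DiscreteTopology D] [AddCommGroup Q] [TopologicalSpace Q]
    (e : Q ≃ₜ+ ((Fin n → ℝ) × (Fin d → UnitAddCircle) × D))
    (hn : Subsingleton (Fin n → ℝ)) (hd : Subsingleton (Fin d → UnitAddCircle)) :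
    DiscreteTopology Q := by
  have h1 : DiscreteTopology (Fin n → ℝ) := Subsingleton.discreteTopology
  have h2 : DiscreteTopology (Fin d → UnitAddCircle) := Subsingleton.discreteTopology
  exact e.toHomeomorph.isEmbedding.discreteTopology

/-- A Lie group in which `p`-powers vanish is discrete. -/
theorem IsLieAb.discreteTopology {p : ℕ} (hp : p.Prime) {Q : Type*} [AddCommGroup Q]
    [TopologicalSpace Q] (hQ : IsLieAb Q) (h : PPowersVanish p Q) : DiscreteTopology Q := by
  obtain ⟨n, d, D, _, _, _, _, ⟨e⟩⟩ := hQ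
  have hv : ∀ y : (Fin n → ℝ) × (Fin d → UnitAddCircle) × D,
      Tendsto (fun k : ℕ => p ^ k • y) atTop (𝓝 0) := by
    intro y
    have h1 : Tendsto (fun k : ℕ => e (p ^ k • e.symm y)) atTop (𝓝 (e 0)) :=
      (e.continuous.tendsto 0).comp (h (e.symm y))
    rw [map_zero] at h1
    exact h1.congr fun k => by rw [map_nsmul, e.apply_symm_apply]
  refine discreteTopology_of_subsingleton e ?_ ?_
  · refine ⟨fun a b => ?_⟩
    rw [← sub_eq_zero]
    have h1 := ((continuous_fst.tendsto _).comp (hv (a - b, 0, 0))).norm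
    -- Multiplying by `p ^ k` never decreases the norm, so only the zero vector can tend to zero.
    have h2 : ‖a - b‖ ≤ ‖(0 : Fin n → ℝ)‖ := by
      refine ge_of_tendsto h1 (Eventually.of_forall fun k => ?_)
      have h3 : (1 : ℝ) ≤ (p : ℝ) ^ k := one_le_pow₀ (by exact_mod_cast hp.one_le)
      simp only [Function.comp_apply, Prod.smul_fst, ← Nat.cast_smul_eq_nsmul ℝ (p ^ k) (a - b),
        norm_smul]
      rw [Nat.cast_pow, Real.norm_of_nonneg (by positivity)]
      exact le_mul_of_one_le_left (norm_nonneg _) h3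
    rw [norm_zero] at h2
    exact norm_le_zero_iff.1 h2
  · rcases Nat.eq_zero_or_pos d with rfl | hd
    · infer_instance
    exfalso
    -- A point of order `p + 1` satisfies `p • t = -t`, so its `p`-power multiples keep constant
    -- nonzero norm.
    let t : UnitAddCircle := (((p + 1 : ℕ) : ℝ)⁻¹ : ℝ)
    have ht : (p + 1) • t = 0 := by
      have h0 : ((p + 1 : ℕ) : ℝ) ≠ 0 := by positivity
      change (p + 1) • ((((p + 1 : ℕ) : ℝ)⁻¹ : ℝ) : UnitAddCircle) = 0
      rw [← AddCircle.coe_nsmul, nsmul_eq_mul, mul_inv_cancel₀ h0]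
      exact AddCircle.coe_period 1
    have htp : p • t = -t := by
      rw [succ_nsmul] at ht
      exact eq_neg_of_add_eq_zero_left ht
    have hnorm : ∀ k : ℕ, ‖p ^ k • t‖ = ‖t‖ := by
      intro k
      induction k with
      | zero => simp
      | succ k ih => rw [pow_succ, mul_smul, htp, smul_neg, norm_neg, ih]
    have h1 := (((continuous_apply (⟨0, hd⟩ : Fin d)).tendsto _).comp
      ((continuous_fst.tendsto _).comp ((continuous_snd.tendsto _).comp
        (hv (0, fun _ => t, 0))))).norm
    have h2 : Tendsto (fun _ : ℕ => ‖t‖) atTop (𝓝 ‖(0 : UnitAddCircle)‖) := by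
      refine h1.congr fun k => ?_
      simpa using hnorm k
    have h3 : t = 0 := by
      have := tendsto_nhds_unique tendsto_const_nhds h2
      rwa [norm_zero, norm_eq_zero] at this
    have h4 : (((p + 1 : ℕ) : ℝ)⁻¹ : ℝ) = 0 := by
      have hlt : (((p + 1 : ℕ) : ℝ)⁻¹ : ℝ) < 1 := by
        apply inv_lt_one_of_one_lt₀
        have := hp.one_lt
        exact_mod_cast Nat.lt_succ_of_lt this
      have hpos : (0 : ℝ) ≤ (((p + 1 : ℕ) : ℝ)⁻¹ : ℝ) := by positivity
      obtain ⟨m, hm⟩ := (AddCircle.coe_eq_zero_iff (1 : ℝ)).1 h3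
      rw [zsmul_eq_mul, mul_one] at hm
      rw [← hm] at hlt hpos ⊢
      have h5 : m < 1 := by exact_mod_cast hlt
      have h6 : 0 ≤ m := by exact_mod_cast hpos
      have : m = 0 := by omega
      simp [this]
    have : ((p + 1 : ℕ) : ℝ) ≠ 0 := by positivity
    exact inv_ne_zero this h4

/-- The cofinal Lie quotients are discrete, so their kernels are open, and in a discrete group
tending to zero means eventually vanishing. -/
theorem IsProP.hasOpenPBasis {p : ℕ} (hp : p.Prime) {G : Type*} [AddCommGroup G]
    [TopologicalSpace G] [IsTopologicalAddGroup G] (hG : IsProP p G) : HasOpenPBasis p G := by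
  intro U hU
  obtain ⟨M, hM, hMU⟩ := hG.proLie U hU
  obtain ⟨N, hN, hNM, hv⟩ := hG.cofinal M hM
  have hd : DiscreteTopology (G ⧸ N) := hN.2.discreteTopology hp hv
  refine ⟨N, QuotientAddGroup.discreteTopology_iff.1 hd, fun x hx => hMU (hNM hx), fun x => ?_⟩
  have h := hv (QuotientAddGroup.mk x)
  rw [nhds_discrete, tendsto_pure] at h
  obtain ⟨n, hn⟩ := h.exists
  exact ⟨n, (QuotientAddGroup.eq_zero_iff _).1 hn⟩

theorem HasOpenPBasis.nonarchimedeanAddGroup {p : ℕ} {G : Type*} [AddCommGroup G]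
    [TopologicalSpace G] [IsTopologicalAddGroup G] (h : HasOpenPBasis p G) :
    NonarchimedeanAddGroup G where
  is_nonarchimedean U hU := by
    obtain ⟨N, hN, hNU, -⟩ := h U hU
    exact ⟨⟨N, hN⟩, hNU⟩

/-- The property passes to quotients. -/
theorem HasOpenPBasis.of_isOpenQuotientMap {p : ℕ} {G H : Type*} [AddCommGroup G]
    [TopologicalSpace G] [AddCommGroup H] [TopologicalSpace H] (h : HasOpenPBasis p G)
    (f : G →+ H) (hf : IsOpenQuotientMap f) : HasOpenPBasis p H := by
  intro U hU
  obtain ⟨N, hN, hNU, hNp⟩ := h (f ⁻¹' U) (hf.continuous.continuousAt (by rwa [map_zero]))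
  refine ⟨N.map f, hf.isOpenMap _ hN, ?_, fun y => ?_⟩
  · rintro _ ⟨x, hx, rfl⟩
    exact hNU hx
  · obtain ⟨x, rfl⟩ := hf.surjective y
    obtain ⟨n, hn⟩ := hNp x
    exact ⟨n, p ^ n • x, hn, map_nsmul f _ x⟩

/-- Open subgroups have countable discrete quotients, hence are co-Lie. Conversely, a Lie quotient
inherits a basis of open subgroups, so it is totally disconnected and its real and circle factors
vanish; every co-Lie subgroup is therefore open. -/
theorem HasOpenPBasis.isProP {p : ℕ} {G : Type*} [AddCommGroup G] [TopologicalSpace G]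
    [IsTopologicalAddGroup G] [PolishSpace G] (h : HasOpenPBasis p G) : IsProP p G := by
  have hcoLie : ∀ N : AddSubgroup G, IsOpen (N : Set G) → N ∈ coLie G := by
    intro N hN
    have := QuotientAddGroup.discreteTopology hN
    have : TopologicalSpace.SeparableSpace (G ⧸ N) :=
      QuotientAddGroup.isOpenQuotientMap_mk.isQuotientMap.separableSpace
    have : Countable (G ⧸ N) := TopologicalSpace.separableSpace_iff_countable.1 this
    exact ⟨AddSubgroup.isClosed_of_isOpen N hN, isLieAb_of_discrete _⟩
  refine ⟨fun U hU => ?_, fun M hM => ?_⟩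
  · obtain ⟨N, hN, hNU, -⟩ := h U hU
    exact ⟨N, hcoLie N hN, hNU⟩
  · have hq : HasOpenPBasis p (G ⧸ M) := h.of_isOpenQuotientMap (QuotientAddGroup.mk' M)
      QuotientAddGroup.isOpenQuotientMap_mk
    have := hq.nonarchimedeanAddGroup
    have : T1Space (G ⧸ M) := QuotientAddGroup.t1Space_iff.2 hM.1
    obtain ⟨n, d, D, _, _, _, _, ⟨e⟩⟩ := hM.2
    have hj : Continuous fun z : (Fin n → ℝ) × (Fin d → UnitAddCircle) =>
        e.symm (z.1, z.2, 0) := e.symm.continuous.comp (by fun_prop)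
    have hsub : Subsingleton ((Fin n → ℝ) × (Fin d → UnitAddCircle)) := by
      refine ⟨fun a b => ?_⟩
      have := e.symm.injective
        ((isPreconnected_range hj).subsingleton (Set.mem_range_self a) (Set.mem_range_self b))
      simp only [Prod.mk.injEq] at this
      exact Prod.ext this.1 this.2.1
    have hd : DiscreteTopology (G ⧸ M) := discreteTopology_of_subsingleton e
      ⟨fun a b => congrArg Prod.fst (Subsingleton.elim (a, (0 : Fin d → UnitAddCircle)) (b, 0))⟩
      ⟨fun a b => congrArg Prod.snd (Subsingleton.elim ((0 : Fin n → ℝ), a) (0, b))⟩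
    have hMo := QuotientAddGroup.discreteTopology_iff.1 hd
    obtain ⟨N, hN, hNM, hNp⟩ := h M (hMo.mem_nhds M.zero_mem)
    refine ⟨N, hcoLie N hN, hNM, fun x => ?_⟩
    obtain ⟨x, rfl⟩ := QuotientAddGroup.mk_surjective x
    obtain ⟨n, hn⟩ := hNp x
    refine tendsto_const_nhds.congr' ?_
    filter_upwards [eventually_ge_atTop n] with k hk
    obtain ⟨m, rfl⟩ := Nat.exists_eq_add_of_le' hk
    symm
    rw [← QuotientAddGroup.mk_nsmul, QuotientAddGroup.eq_zero_iff, pow_add, mul_smul]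
    exact N.nsmul_mem hn _


/-! ### Discrete divisible groups are injective relative to nonarchimedean quotients -/

theorem continuous_of_isOpen_of_le_ker {G D : Type*} [AddCommGroup G] [TopologicalSpace G]
    [IsTopologicalAddGroup G] [AddCommGroup D] [TopologicalSpace D] [IsTopologicalAddGroup D]
    (f : G →+ D) (N : AddSubgroup G) (hN : IsOpen (N : Set G)) (h : ∀ x ∈ N, f x = 0) :
    Continuous f := by
  refine continuous_of_continuousAt_zero f ?_
  rw [ContinuousAt, map_zero]
  refine tendsto_const_nhds.congr' ?_
  filter_upwards [hN.mem_nhds N.zero_mem] with x hx using (h x hx).symm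

section Extension

variable {A B C : Type*} [AddCommGroup A] [TopologicalSpace A] [AddCommGroup B]
  [TopologicalSpace B] [IsTopologicalAddGroup B] [AddCommGroup C] [TopologicalSpace C]
  [NonarchimedeanAddGroup C] {f : A →ₜ+ B} {g : B →ₜ+ C}

/-- In an extension of a nonarchimedean group, open subgroups of the kernel contain the trace of
an open subgroup. -/
theorem IsShortExact.exists_openAddSubgroup (h : IsShortExact f g) (V : AddSubgroup A)
    (hV : IsOpen (V : Set A)) :
    ∃ K : AddSubgroup B, IsOpen (K : Set B) ∧ ∀ a, f a ∈ K → a ∈ V := by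
  obtain ⟨U, hU, hUV⟩ := h.isClosedEmbedding.isInducing.isOpen_iff.1 hV
  have hmem : ∀ a, f a ∈ U → a ∈ V := fun a ha => by
    have : a ∈ (V : Set A) := hUV ▸ ha
    exact this
  have h0 : (0 : B) ∈ U := by
    have : (0 : A) ∈ f ⁻¹' U := hUV ▸ V.zero_mem
    simpa using this
  obtain ⟨W, hW, hWU⟩ : ∃ W ∈ 𝓝 (0 : B), ∀ x ∈ W, ∀ y ∈ W, ∀ z ∈ W, x + y - z ∈ U := by
    have hc : ContinuousAt (fun q : B × B × B => q.1 + q.2.1 - q.2.2) (0, 0, 0) :=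
      Continuous.continuousAt (by fun_prop)
    have := hc.preimage_mem_nhds (hU.mem_nhds (by simpa using h0))
    rw [nhds_prod_eq, nhds_prod_eq] at this
    obtain ⟨S, hS, T, hT, hST⟩ := mem_prod_iff.1 this
    obtain ⟨S', hS', T', hT', hST'⟩ := mem_prod_iff.1 hT
    refine ⟨S ∩ S' ∩ T', inter_mem (inter_mem hS hS') hT', fun x hx y hy z hz => ?_⟩
    exact hST (Set.mk_mem_prod hx.1.1 (hST' (Set.mk_mem_prod hy.1.2 hz.2)))
  have hW0 : (0 : B) ∈ W := mem_of_mem_nhds hW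
  obtain ⟨H, hH⟩ := NonarchimedeanAddGroup.is_nonarchimedean (g '' W) (by
    have := h.isOpenQuotientMap.isOpenMap.image_mem_nhds hW
    rwa [map_zero] at this)
  have hker : ∀ x, g x = 0 → ∃ a, f a = x := fun x hx => (h.exact x).1 hx
  have hgf : ∀ a, g (f a) = 0 := fun a => (h.exact _).2 ⟨a, rfl⟩
  have hmem' : ∀ x ∈ W, ∀ y ∈ W, ∀ z ∈ W, g (x + y) = g z → ∃ a ∈ V, f a = x + y - z := by
    intro x hx y hy z hz hxyz
    obtain ⟨a, ha⟩ := hker (x + y - z) (by rw [map_sub, hxyz, sub_self])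
    exact ⟨a, hmem a (ha ▸ hWU x hx y hy z hz), ha⟩
  -- `K` consists of the elements over `H` that lie in `W` modulo `f '' V`. Since `H ⊆ g '' W`, a
  -- sum of two elements of `W` lying over `H` can be replaced by some `z ∈ W` with the same image;
  -- the error is in the kernel and in `U`, hence in `f '' V`.
  let K : AddSubgroup B :=
    { carrier := {b | g b ∈ H ∧ ∃ v ∈ V, b - f v ∈ W}
      zero_mem' := ⟨by rw [map_zero]; exact H.zero_mem, 0, V.zero_mem, by simpa using hW0⟩
      add_mem' := by
        rintro x y ⟨hx, v, hv, hxv⟩ ⟨hy, w, hw, hyw⟩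
        have hxy : g (x + y) ∈ H := by rw [map_add]; exact H.add_mem hx hy
        obtain ⟨z, hz, hgz⟩ := hH hxy
        obtain ⟨a, ha, hfa⟩ := hmem' _ hxv _ hyw z hz
          (by rw [hgz, map_add, map_sub, map_sub, hgf, hgf, sub_zero, sub_zero, map_add])
        refine ⟨hxy, a + v + w, V.add_mem (V.add_mem ha hv) hw, ?_⟩
        rw [map_add, map_add, hfa]
        convert hz using 1
        abel
      neg_mem' := by
        rintro x ⟨hx, v, hv, hxv⟩
        have hnx : g (-x) ∈ H := by rw [map_neg]; exact H.neg_mem hx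
        obtain ⟨z, hz, hgz⟩ := hH hnx
        obtain ⟨a, ha, hfa⟩ := hmem' _ hxv z hz 0 hW0
          (by rw [map_add, map_sub, hgz, hgf, map_neg, map_zero, sub_zero, add_neg_cancel])
        refine ⟨hnx, -(a + v), V.neg_mem (V.add_mem ha hv), ?_⟩
        rw [map_neg, map_add, hfa]
        convert hz using 1
        abel }
  refine ⟨K, ?_, ?_⟩
  · refine AddSubgroup.isOpen_of_mem_nhds (g := 0) K ?_
    have hHn : g ⁻¹' (H : Set C) ∈ 𝓝 (0 : B) :=
      g.continuous_toFun.continuousAt.preimage_mem_nhds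
        (by rw [show g.toFun 0 = 0 from map_zero g]; exact H.mem_nhds_zero)
    filter_upwards [hW, hHn] with x hx hx'
    exact ⟨hx', 0, V.zero_mem, by rwa [map_zero, sub_zero]⟩
  · rintro a ⟨-, v, hv, hav⟩
    have h1 : a - v ∈ V := hmem _ (by
      rw [map_sub]
      simpa using hWU _ hav 0 hW0 0 hW0)
    simpa using V.add_mem h1 hv

/-- An open subgroup `K` of `B` with trace inside the kernel of `φ` makes the problem algebraic:
extend over `B ⧸ K` by divisibility, and continuity is automatic. -/
theorem IsShortExact.exists_extension_discrete (h : IsShortExact f g) {D : Type*}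
    [AddCommGroup D] [TopologicalSpace D] [DiscreteTopology D] (hD : IsDivisible D)
    (φ : A →ₜ+ D) : ∃ ψ : B →ₜ+ D, ∀ a, ψ (f a) = φ a := by
  obtain ⟨K, hK, hKφ⟩ := h.exists_openAddSubgroup (φ : A →+ D).ker
    ((isOpen_discrete ({0} : Set D)).preimage φ.continuous_toFun)
  obtain ⟨ψ, hψ⟩ := hD.exists_extension ((QuotientAddGroup.mk' K).comp (f : A →+ B)) (φ : A →+ D)
    (fun a ha => hKφ a ((QuotientAddGroup.eq_zero_iff _).1 ha))
  refine ⟨⟨ψ.comp (QuotientAddGroup.mk' K),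
    continuous_of_isOpen_of_le_ker _ K hK fun x hx => ?_⟩, hψ⟩
  rw [AddMonoidHom.comp_apply, QuotientAddGroup.mk'_apply, (QuotientAddGroup.eq_zero_iff x).2 hx,
    map_zero]

theorem IsShortExact.exists_extension_pi (h : IsShortExact f g) {ι : Type*} {D : ι → Type*}
    [∀ i, AddCommGroup (D i)] [∀ i, TopologicalSpace (D i)] [∀ i, DiscreteTopology (D i)]
    (hD : ∀ i, IsDivisible (D i)) {G : Type*} [AddCommGroup G] [TopologicalSpace G]
    (e : G ≃ₜ+ ∀ i, D i) (φ : A →ₜ+ G) : ∃ ψ : B →ₜ+ G, ∀ a, ψ (f a) = φ a := by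
  have hφ : ∀ i, Continuous fun a => e (φ a) i := fun i =>
    (continuous_apply i).comp (e.continuous.comp φ.continuous_toFun)
  choose ψ hψ using fun i => h.exists_extension_discrete (hD i)
    ⟨(Pi.evalAddMonoidHom D i).comp ((e : G →+ ∀ i, D i).comp (φ : A →+ G)), hφ i⟩
  refine ⟨⟨(e.symm : (∀ i, D i) →+ G).comp (AddMonoidHom.pi fun i => (ψ i : B →+ D i)), ?_⟩, ?_⟩
  · exact e.symm.continuous.comp (continuous_pi fun i => (ψ i).continuous_toFun)
  · intro a
    apply e.injective
    refine (e.apply_symm_apply _).trans (funext fun i => ?_)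
    exact hψ i a

end Extension

/-! ### Groups with a basis of divisible zero neighbourhoods -/

/-- The divisible subgroups that are zero neighbourhoods form a basis. -/
def HasDivisibleBasis (G : Type*) [AddCommGroup G] [TopologicalSpace G] : Prop :=
  ∀ U ∈ 𝓝 (0 : G), ∃ V : AddSubgroup G, (V : Set G) ∈ 𝓝 (0 : G) ∧ (V : Set G) ⊆ U ∧ IsDivisible V

theorem hasBasis_divisible_iff {G : Type*} [AddCommGroup G] [TopologicalSpace G] :
    (𝓝 (0 : G)).HasBasis
      (fun V : AddSubgroup G => (V : Set G) ∈ 𝓝 (0 : G) ∧ Nonempty (DivisibleBy V ℕ))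
      (fun V => (V : Set G)) ↔ HasDivisibleBasis G := by
  constructor
  · intro h U hU
    obtain ⟨V, ⟨hV, hd⟩, hVU⟩ := h.mem_iff.1 hU
    exact ⟨V, hV, hVU, nonempty_divisibleBy_iff.1 hd⟩
  · refine fun h => ⟨fun U => ⟨fun hU => ?_, ?_⟩⟩
    · obtain ⟨V, hV, hVU, hd⟩ := h U hU
      exact ⟨V, ⟨hV, nonempty_divisibleBy_iff.2 hd⟩, hVU⟩
    · rintro ⟨V, ⟨hV, -⟩, hVU⟩
      exact mem_of_superset hV hVU

/-- Only openness at zero is required, so that both open quotient maps and retractions qualify. -/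
theorem HasDivisibleBasis.map {G H : Type*} [AddCommGroup G] [TopologicalSpace G]
    [AddCommGroup H] [TopologicalSpace H] (h : HasDivisibleBasis G) (f : G →+ H)
    (hf : Continuous f) (hopen : 𝓝 (0 : H) ≤ Filter.map f (𝓝 0)) : HasDivisibleBasis H := by
  intro U hU
  obtain ⟨V, hV, hVU, hd⟩ := h (f ⁻¹' U) (hf.continuousAt (by rwa [map_zero]))
  refine ⟨V.map f, hopen (image_mem_map hV), ?_,
    hd.of_surjective (f.addSubgroupMap V) (f.addSubgroupMap_surjective V)⟩
  rintro _ ⟨x, hx, rfl⟩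
  exact hVU hx

theorem HasDivisibleBasis.of_isOpenQuotientMap {G H : Type*} [AddCommGroup G] [TopologicalSpace G]
    [AddCommGroup H] [TopologicalSpace H] (h : HasDivisibleBasis G) (f : G →+ H)
    (hf : IsOpenQuotientMap f) : HasDivisibleBasis H :=
  h.map f hf.continuous (by simpa using hf.isOpenMap.nhds_le 0)

theorem HasDivisibleBasis.of_retraction {G H : Type*} [AddCommGroup G] [TopologicalSpace G]
    [AddCommGroup H] [TopologicalSpace H] (h : HasDivisibleBasis G) (r : G →ₜ+ H) (i : H →ₜ+ G)
    (hri : ∀ x, r (i x) = x) : HasDivisibleBasis H := by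
  refine h.map (r : G →+ H) r.continuous_toFun fun s hs => ?_
  have h1 : i ⁻¹' (r ⁻¹' s) ∈ 𝓝 (0 : H) :=
    i.continuous_toFun.continuousAt.preimage_mem_nhds
      (by rw [show i.toFun 0 = 0 from map_zero i]; exact hs)
  rwa [← Set.preimage_comp, show r ∘ i = id from funext hri, Set.preimage_id] at h1

theorem exists_finset_pi_bot_subset {ι : Type*} {D : ι → Type*} [∀ i, AddCommGroup (D i)]
    [∀ i, TopologicalSpace (D i)] {U : Set (∀ i, D i)} (hU : U ∈ 𝓝 0) :
    ∃ I : Finset ι, (AddSubgroup.pi (I : Set ι) fun i => (⊥ : AddSubgroup (D i)) : Set _) ⊆ U := by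
  rw [nhds_pi, Filter.mem_pi'] at hU
  obtain ⟨I, t, ht, htU⟩ := hU
  refine ⟨I, fun x hx => htU fun i hi => ?_⟩
  rw [(hx i hi : x i = 0)]
  exact mem_of_mem_nhds (ht i)

theorem isOpen_pi_bot {ι : Type*} {D : ι → Type*} [∀ i, AddCommGroup (D i)]
    [∀ i, TopologicalSpace (D i)] [∀ i, DiscreteTopology (D i)] (I : Finset ι) :
    IsOpen (AddSubgroup.pi (I : Set ι) fun i => (⊥ : AddSubgroup (D i)) : Set (∀ i, D i)) :=
  isOpen_set_pi I.finite_toSet fun _ _ => isOpen_discrete _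

theorem hasDivisibleBasis_pi {ι : Type*} {D : ι → Type*} [∀ i, AddCommGroup (D i)]
    [∀ i, TopologicalSpace (D i)] [∀ i, DiscreteTopology (D i)]
    (hD : ∀ i, IsDivisible (D i)) : HasDivisibleBasis (∀ i, D i) := by
  classical
  intro U hU
  obtain ⟨I, hI⟩ := exists_finset_pi_bot_subset hU
  refine ⟨_, (isOpen_pi_bot I).mem_nhds (AddSubgroup.zero_mem _), hI, ?_⟩
  rintro n hn ⟨x, hx⟩
  choose y hy using fun i => hD i n hn (x i)
  refine ⟨⟨fun i => if i ∈ I then 0 else y i, fun i hi => if_pos hi⟩, Subtype.ext (funext fun i => ?_)⟩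
  by_cases hi : i ∈ I
  · simpa [hi] using (hx i hi : x i = 0).symm
  · simpa [hi] using hy i

theorem hasOpenPBasis_pi {p : ℕ} {ι : Type*} {D : ι → Type*} [∀ i, AddCommGroup (D i)]
    [∀ i, TopologicalSpace (D i)] [∀ i, DiscreteTopology (D i)]
    (hD : ∀ i, IsPTorsion p (D i)) : HasOpenPBasis p (∀ i, D i) := by
  intro U hU
  obtain ⟨I, hI⟩ := exists_finset_pi_bot_subset hU
  refine ⟨_, isOpen_pi_bot I, hI, fun x => ?_⟩
  choose n hn using fun i => hD i (x i)
  refine ⟨I.sup n, fun i hi => ?_⟩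
  obtain ⟨k, hk⟩ := Nat.exists_eq_add_of_le' (Finset.le_sup (f := n) hi)
  change p ^ I.sup n • x i = 0
  rw [hk, pow_add, mul_smul, hn, smul_zero]

theorem HasDivisibleBasis.prod {G H : Type*} [AddCommGroup G] [TopologicalSpace G]
    [AddCommGroup H] [TopologicalSpace H] (hG : HasDivisibleBasis G) (hH : HasDivisibleBasis H) :
    HasDivisibleBasis (G × H) := by
  intro U hU
  rw [Prod.zero_eq_mk, nhds_prod_eq] at hU
  obtain ⟨S, hS, T, hT, hST⟩ := mem_prod_iff.1 hU
  obtain ⟨V, hV, hVS, hVd⟩ := hG S hS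
  obtain ⟨W, hW, hWT, hWd⟩ := hH T hT
  refine ⟨V.prod W, ?_, (Set.prod_mono hVS hWT).trans hST, ?_⟩
  · rw [Prod.zero_eq_mk, nhds_prod_eq]
    exact prod_mem_prod hV hW
  · exact (hVd.prod hWd).of_surjective (V.prodEquiv W).symm.toAddMonoidHom
      (V.prodEquiv W).symm.surjective

/-! ### Decomposition as a product of discrete divisible groups -/

theorem exists_antitone_divisible_subgroups {G : Type*} [AddCommGroup G] [TopologicalSpace G]
    [IsTopologicalAddGroup G] [FirstCountableTopology G] (hd : IsDivisible G)
    (hb : HasDivisibleBasis G) :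
    ∃ V : ℕ → AddSubgroup G, V 0 = ⊤ ∧ Antitone V ∧ (∀ n, IsOpen (V n : Set G)) ∧
      (∀ n, IsDivisible (V n)) ∧ ∀ U ∈ 𝓝 (0 : G), ∃ n, (V n : Set G) ⊆ U := by
  obtain ⟨U, hU⟩ := (𝓝 (0 : G)).exists_antitone_basis
  let S := {V : AddSubgroup G // IsOpen (V : Set G) ∧ IsDivisible V}
  have step : ∀ (n : ℕ) (W : S), ∃ V : S, V.1 ≤ W.1 ∧ (V.1 : Set G) ⊆ U n := by
    intro n W
    obtain ⟨V, hV, hVU, hVd⟩ := hb (W.1 ∩ U n)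
      (inter_mem (W.2.1.mem_nhds W.1.zero_mem) (hU.mem n))
    exact ⟨⟨V, AddSubgroup.isOpen_of_mem_nhds V hV, hVd⟩, fun x hx => (hVU hx).1,
      fun x hx => (hVU hx).2⟩
  choose F hF hFU using step
  let V : ℕ → S := fun n => Nat.rec ⟨⊤, isOpen_univ,
    hd.of_surjective (AddSubgroup.topEquiv (G := G)).symm.toAddMonoidHom
      (AddSubgroup.topEquiv (G := G)).symm.surjective⟩ (fun n W => F n W) n
  refine ⟨fun n => (V n).1, rfl, antitone_nat_of_succ_le fun n => hF n (V n),
    fun n => (V n).2.1, fun n => (V n).2.2, fun T hT => ?_⟩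
  obtain ⟨n, -, hn⟩ := hU.1.mem_iff.1 hT
  exact ⟨n + 1, (hFU n (V n)).trans hn⟩

/-- A Polish abelian group with an antitone basis of open divisible subgroups `V n`, the first of
them the whole group, is the product of the quotients `V n / V (n + 1)`. -/
theorem nonempty_continuousAddEquiv_pi_quotient {G : Type*} [AddCommGroup G]
    [TopologicalSpace G] [IsTopologicalAddGroup G] [PolishSpace G] (V : ℕ → AddSubgroup G)
    (hV0 : V 0 = ⊤) (hanti : Antitone V) (hopen : ∀ n, IsOpen (V n : Set G))
    (hdiv : ∀ n, IsDivisible (V n)) (hbasis : ∀ U ∈ 𝓝 (0 : G), ∃ n, (V n : Set G) ⊆ U) :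
    Nonempty (G ≃ₜ+ ∀ n, V n ⧸ (V (n + 1)).addSubgroupOf (V n)) := by
  have hdisc : ∀ n, DiscreteTopology (V n ⧸ (V (n + 1)).addSubgroupOf (V n)) := fun n =>
    QuotientAddGroup.discreteTopology ((hopen (n + 1)).preimage continuous_subtype_val)
  -- Divisibility of the quotient extends the projection of `V n` to all of `G`. The choices are
  -- unrelated for different `n`, yet `f n` kills `V (n + 1)`, so the system is triangular.
  have hext : ∀ n, ∃ f : G →+ V n ⧸ (V (n + 1)).addSubgroupOf (V n),
      ∀ x : V n, f x = QuotientAddGroup.mk x := fun n =>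
    ((hdiv n).of_surjective (QuotientAddGroup.mk' _)
      (QuotientAddGroup.mk'_surjective _)).exists_extension (V n).subtype
        (QuotientAddGroup.mk' _) fun a ha => by rw [(Subtype.ext ha : a = 0), map_zero]
  choose f hf using hext
  have hf0 : ∀ n x, x ∈ V (n + 1) → f n x = 0 := fun n x hx => by
    rw [hf n ⟨x, hanti n.le_succ hx⟩]
    exact (QuotientAddGroup.eq_zero_iff _).2 hx
  have hmem : ∀ n x, (∀ m < n, f m x = 0) → x ∈ V n := by
    intro n
    induction n with
    | zero => exact fun x _ => hV0 ▸ AddSubgroup.mem_top x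
    | succ n ih =>
      intro x hx
      have h1 := hx n n.lt_succ_self
      rw [hf n ⟨x, ih x fun m hm => hx m (hm.trans n.lt_succ_self)⟩] at h1
      have h2 := (QuotientAddGroup.eq_zero_iff _).1 h1
      exact h2
  have hcont : ∀ n, Continuous (f n) := fun n =>
    continuous_of_isOpen_of_le_ker (f n) (V (n + 1)) (hopen _) (hf0 n)
  let F := AddMonoidHom.pi f
  have hFc : Continuous F := continuous_pi hcont
  have hind : IsInducing F := by
    rw [IsTopologicalAddGroup.isInducing_iff_nhds_zero]
    refine le_antisymm ?_ fun U hU => ?_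
    · rw [← tendsto_iff_comap]
      simpa using hFc.tendsto 0
    · obtain ⟨n, hn⟩ := hbasis U hU
      refine ⟨_, (isOpen_pi_bot (Finset.range n)).mem_nhds (AddSubgroup.zero_mem _),
        fun x hx => hn (hmem n x fun m hm => ?_)⟩
      exact hx m (by simpa using hm)
  -- Correcting coordinate `n` by an element of `V n` leaves the earlier coordinates unchanged.
  -- Hence the range is dense, and it is closed by completeness.
  have hfin : ∀ (d : ∀ n, V n ⧸ (V (n + 1)).addSubgroupOf (V n)) (n : ℕ),
      ∃ x, ∀ m < n, f m x = d m := by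
    intro d n
    induction n with
    | zero => exact ⟨0, fun m hm => absurd hm m.not_lt_zero⟩
    | succ n ih =>
      obtain ⟨x, hx⟩ := ih
      obtain ⟨v, hv⟩ := QuotientAddGroup.mk_surjective (d n - f n x)
      refine ⟨x + v, fun m hm => ?_⟩
      rw [map_add]
      rcases Nat.lt_succ_iff_lt_or_eq.1 hm with hm' | rfl
      · rw [hx m hm', hf0 m v (hanti (Nat.succ_le_of_lt hm') v.2), add_zero]
      · rw [hf, hv, add_sub_cancel]
  have hcl := isClosedEmbedding_of_isInducing F hind
  have hsurj : Function.Surjective F := by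
    rw [← Set.range_eq_univ, ← hcl.isClosed_range.closure_eq]
    refine DenseRange.closure_range fun d => mem_closure_iff_nhds.2 fun t ht => ?_
    obtain ⟨I, hI⟩ := exists_finset_pi_bot_subset (U := (fun z => d + z) ⁻¹' t)
      ((continuous_const.add continuous_id).continuousAt.preimage_mem_nhds (by simpa using ht))
    obtain ⟨x, hx⟩ := hfin d (I.sup id + 1)
    refine ⟨F x, ?_, x, rfl⟩
    have h1 : F x - d ∈ (fun z => d + z) ⁻¹' t := hI fun i hi => by
      have : f i x = d i := hx i (Nat.lt_succ_of_le (Finset.le_sup (f := id) hi))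
      exact sub_eq_zero.2 this
    simpa using h1
  exact ⟨{ AddEquiv.ofBijective F ⟨hcl.injective, hsurj⟩ with
    continuous_toFun := hFc
    continuous_invFun := by
      refine hind.continuous_iff.2 ?_
      refine continuous_id.congr fun y => ?_
      exact ((AddEquiv.ofBijective F ⟨hcl.injective, hsurj⟩).apply_symm_apply y).symm }⟩

theorem exists_continuousAddEquiv_pi_discrete {p : ℕ} {G : Type u} [AddCommGroup G]
    [TopologicalSpace G] [IsTopologicalAddGroup G] [PolishSpace G] (hp : HasOpenPBasis p G)
    (hd : IsDivisible G) (hb : HasDivisibleBasis G) :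
    ∃ (D : ℕ → Type u) (_ : ∀ n, AddCommGroup (D n)) (_ : ∀ n, TopologicalSpace (D n)),
      (∀ n, DiscreteTopology (D n)) ∧ (∀ n, Countable (D n)) ∧ (∀ n, IsDivisible (D n)) ∧
      (∀ n, IsPTorsion p (D n)) ∧ Nonempty (G ≃ₜ+ ∀ n, D n) := by
  obtain ⟨V, hV0, hanti, hopen, hdiv, hbasis⟩ := exists_antitone_divisible_subgroups hd hb
  have hdisc : ∀ n, DiscreteTopology (V n ⧸ (V (n + 1)).addSubgroupOf (V n)) := fun n =>
    QuotientAddGroup.discreteTopology ((hopen (n + 1)).preimage continuous_subtype_val)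
  refine ⟨fun n => V n ⧸ (V (n + 1)).addSubgroupOf (V n), inferInstance, inferInstance, hdisc,
    fun n => ?_, fun n => (hdiv n).of_surjective (QuotientAddGroup.mk' _)
      (QuotientAddGroup.mk'_surjective _), fun n x => ?_,
    nonempty_continuousAddEquiv_pi_quotient V hV0 hanti hopen hdiv hbasis⟩
  · have : SecondCountableTopology (V n) := TopologicalSpace.Subtype.secondCountableTopology _
    have : TopologicalSpace.SeparableSpace (V n ⧸ (V (n + 1)).addSubgroupOf (V n)) :=
      QuotientAddGroup.isOpenQuotientMap_mk.isQuotientMap.separableSpace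
    exact TopologicalSpace.separableSpace_iff_countable.1 this
  · obtain ⟨x, rfl⟩ := QuotientAddGroup.mk_surjective x
    obtain ⟨N, -, hN, hNp⟩ := hp _ ((hopen (n + 1)).mem_nhds (V (n + 1)).zero_mem)
    obtain ⟨k, hk⟩ := hNp x
    exact ⟨k, (QuotientAddGroup.eq_zero_iff _).2 (hN hk)⟩


/-! ### Products of Prüfer groups -/

theorem exists_equiv_below (K : Type*) [Countable K] : ∃ α : ℕ∞, Nonempty (K ≃ Below α) := by
  rcases finite_or_infinite K with hK | hK
  · obtain ⟨n, ⟨e⟩⟩ := Finite.exists_equiv_fin K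
    exact ⟨n, ⟨e.trans (Fin.equivSubtype.trans
      (Equiv.subtypeEquivRight fun k => (Nat.cast_lt (α := ℕ∞)).symm))⟩⟩
  · obtain ⟨e⟩ := nonempty_equiv_of_countable (α := K) (β := ℕ)
    exact ⟨⊤, ⟨e.trans (Equiv.subtypeUnivEquiv fun n => ENat.natCast_lt_top n).symm⟩⟩

theorem PruferSum.isDivisible (p : ℕ) [Fact p.Prime] : IsDivisible (PruferSum p) :=
  (Prufer.isDivisible p).finsupp (ι := ℕ)

theorem PruferSum.isPTorsion (p : ℕ) : IsPTorsion p (PruferSum p) :=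
  (Prufer.isPTorsion p).finsupp (ι := ℕ)

/-- A countable divisible `p`-torsion group is a finite power of the Prüfer group, or the direct
sum of infinitely many copies of it. -/
theorem IsPTorsion.finite_power_or_pruferSum {p : ℕ} [Fact p.Prime] {D : Type u} [AddCommGroup D]
    [Countable D] (h : IsPTorsion p D) (hD : IsDivisible D) :
    Nonempty (D ≃+ PruferSum p) ∨
      ∃ (ι : Type u) (_ : Finite ι), Nonempty (D ≃+ (ι → Prufer p)) := by
  obtain ⟨ι, hι, ⟨e⟩⟩ := h.exists_addEquiv_finsupp hD
  rcases finite_or_infinite ι with hfin | hinf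
  · exact .inr ⟨ι, hfin, ⟨e.trans (Finsupp.linearEquivFunOnFinite ℤ (Prufer p) ι).toAddEquiv⟩⟩
  · obtain ⟨k⟩ := nonempty_equiv_of_countable (α := ι) (β := ℕ)
    exact .inl ⟨e.trans (Finsupp.domCongr k)⟩

/-- Factors isomorphic to `PruferSum p` are counted by `β`. The others are finite powers of the
Prüfer group, and their index sets together form a countable set counted by `α`. -/
theorem exists_continuousAddEquiv_prufer {p : ℕ} [Fact p.Prime] (D : ℕ → Type u)
    [∀ n, AddCommGroup (D n)] [∀ n, TopologicalSpace (D n)] [∀ n, DiscreteTopology (D n)]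
    [∀ n, Countable (D n)] (hD : ∀ n, IsDivisible (D n)) (hp : ∀ n, IsPTorsion p (D n)) :
    ∃ α β : ℕ∞, Nonempty ((∀ n, D n) ≃ₜ+ ((Below α → Prufer p) × (Below β → PruferSum p))) := by
  classical
  let S : ℕ → Prop := fun n => Nonempty (D n ≃+ PruferSum p)
  have hfin : ∀ n : {n // ¬ S n}, ∃ (ι : Type u) (_ : Finite ι),
      Nonempty (D n ≃+ (ι → Prufer p)) := fun n =>
    ((hp n).finite_power_or_pruferSum (hD n)).resolve_left n.2
  choose ι hι e using hfin
  replace e := fun n => (e n).some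
  have e' : ∀ n : {n // S n}, D n ≃+ PruferSum p := fun n => n.2.some
  obtain ⟨α, ⟨κ⟩⟩ := exists_equiv_below (Σ n, ι n)
  obtain ⟨β, ⟨σ⟩⟩ := exists_equiv_below {n // S n}
  refine ⟨α, β, ⟨{
    toFun := fun d => (fun j => e (κ.symm j).1 (d (κ.symm j).1) (κ.symm j).2,
      fun j => e' (σ.symm j) (d (σ.symm j)))
    invFun := fun z n => if h : S n then (e' ⟨n, h⟩).symm (z.2 (σ ⟨n, h⟩)) else
      (e ⟨n, h⟩).symm fun i => z.1 (κ ⟨⟨n, h⟩, i⟩)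
    left_inv := fun d => funext fun n => ?_
    right_inv := fun z => ?_
    map_add' := fun c d => Prod.ext (funext fun j => ?_) (funext fun j => ?_)
    continuous_toFun := ?_
    continuous_invFun := ?_ }⟩⟩
  · by_cases h : S n
    · have h1 := congrArg (fun s => e' s (d s)) (σ.symm_apply_apply ⟨n, h⟩)
      simp only [h, dite_true]
      exact (AddEquiv.symm_apply_eq _).2 h1
    · simp only [h, dite_false]
      refine (AddEquiv.symm_apply_eq _).2 (funext fun i => ?_)
      exact congrArg (fun k : Σ n, ι n => e k.1 (d k.1) k.2) (κ.symm_apply_apply ⟨⟨n, h⟩, i⟩)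
  · refine Prod.ext (funext fun j => ?_) (funext fun j => ?_)
    · obtain ⟨k, rfl⟩ := κ.surjective j
      simp only [(κ.symm (κ k)).1.2, dite_false, AddEquiv.apply_symm_apply]
      exact congrArg z.1 (κ.apply_symm_apply (κ k))
    · obtain ⟨k, rfl⟩ := σ.surjective j
      simp [k.2]
  · simp
  · simp
  · refine Continuous.prodMk (continuous_pi fun j => ?_) (continuous_pi fun j => ?_)
    · exact (continuous_of_discreteTopology
        (f := fun d => e (κ.symm j).1 d (κ.symm j).2)).comp (continuous_apply _)
    · exact (continuous_of_discreteTopology (f := e' (σ.symm j))).comp (continuous_apply _)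
  · refine continuous_pi fun n => ?_
    by_cases h : S n
    · simp only [h, dite_true]
      exact (continuous_of_discreteTopology (f := (e' ⟨n, h⟩).symm)).comp
        ((continuous_apply _).comp continuous_snd)
    · simp only [h, dite_false]
      -- Finiteness of the index set is essential here: it makes the product topology on `ι → Prufer
      -- p` discrete.
      exact (continuous_of_discreteTopology (f := (e ⟨n, h⟩).symm)).comp
        (continuous_pi fun i => (continuous_apply _).comp continuous_fst)

/-- Every pro-`p` Polish abelian group is a closed subgroup of `(ℤ(p^∞)^(ω))^ω`. -/
theorem HasOpenPBasis.exists_isClosedEmbedding {p : ℕ} [Fact p.Prime] {G : Type u}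
    [AddCommGroup G] [TopologicalSpace G] [IsTopologicalAddGroup G] [PolishSpace G]
    (h : HasOpenPBasis p G) : ∃ f : G →ₜ+ (ℕ → PruferSum p), IsClosedEmbedding f := by
  obtain ⟨U, hU⟩ := (𝓝 (0 : G)).exists_antitone_basis
  choose N hN hNU hNp using fun n => h (U n) (hU.mem n)
  -- Having kernel exactly `N n`, these maps are continuous and jointly recover the topology.
  have hφ : ∀ n, ∃ φ : G →+ PruferSum p, ∀ x, φ x = 0 ↔ x ∈ N n := by
    intro n
    have hd := QuotientAddGroup.discreteTopology (hN n)
    have : TopologicalSpace.SeparableSpace (G ⧸ N n) :=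
      QuotientAddGroup.isOpenQuotientMap_mk.isQuotientMap.separableSpace
    have : Countable (G ⧸ N n) := TopologicalSpace.separableSpace_iff_countable.1 this
    have hpt : IsPTorsion p (G ⧸ N n) := fun x => by
      obtain ⟨x, rfl⟩ := QuotientAddGroup.mk_surjective x
      obtain ⟨k, hk⟩ := hNp n x
      exact ⟨k, (QuotientAddGroup.eq_zero_iff _).2 hk⟩
    obtain ⟨ι, hι, φ, hφ, -⟩ := hpt.exists_embedding
    obtain ⟨j, hj⟩ := exists_injective_nat ι
    let ψ : (ι →₀ Prufer p) →+ PruferSum p := Finsupp.mapDomain.addMonoidHom j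
    have hψ : Function.Injective ψ := Finsupp.mapDomain_injective hj
    refine ⟨(ψ.comp φ).comp (QuotientAddGroup.mk' (N n)), fun x => ?_⟩
    rw [AddMonoidHom.comp_apply, map_eq_zero_iff _ (hψ.comp hφ : Function.Injective (ψ.comp φ))]
    exact QuotientAddGroup.eq_zero_iff x
  choose φ hφ using hφ
  let F := AddMonoidHom.pi φ
  have hF : Continuous F := continuous_pi fun n =>
    continuous_of_isOpen_of_le_ker (φ n) (N n) (hN n) fun x hx => (hφ n x).2 hx
  refine ⟨⟨F, hF⟩, isClosedEmbedding_of_isInducing F ?_⟩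
  rw [IsTopologicalAddGroup.isInducing_iff_nhds_zero]
  refine le_antisymm ?_ fun T hT => ?_
  · rw [← tendsto_iff_comap]
    simpa using hF.tendsto 0
  · obtain ⟨n, -, hn⟩ := hU.1.mem_iff.1 hT
    refine ⟨_, (isOpen_pi_bot {n}).mem_nhds (AddSubgroup.zero_mem _),
      fun x hx => hn (hNU n ((hφ n x).1 ?_))⟩
    exact hx n (by simp)

/-- Injectivity is tested on groups in `Type u`, so the ambient power has to be lifted there. -/
instance (p : ℕ) : PolishSpace (ULift.{u} (ℕ → PruferSum p)) :=
  IsClosedEmbedding.uliftDown.polishSpace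

instance (p : ℕ) : IsTopologicalAddGroup (ULift.{u} (ℕ → PruferSum p)) where
  continuous_add := continuous_uliftUp.comp
    ((continuous_uliftDown.comp continuous_fst).add (continuous_uliftDown.comp continuous_snd))
  continuous_neg := continuous_uliftUp.comp continuous_uliftDown.neg

/-- The canonical homomorphism from a group to its universe lift. -/
def uliftUpHom (X : Type*) [AddCommGroup X] : X →+ ULift.{v} X where
  toFun := ULift.up
  map_zero' := rfl
  map_add' _ _ := rfl

theorem isOpenQuotientMap_uliftUpHom (X : Type*) [AddCommGroup X] [TopologicalSpace X] :
    IsOpenQuotientMap (uliftUpHom.{v} X) :=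
  Homeomorph.ulift.symm.isOpenQuotientMap

/-! ### Short exact sequences and splittings -/

section Splitting

variable {A B C : Type*} [AddCommGroup A] [TopologicalSpace A] [AddCommGroup B]
  [TopologicalSpace B] [AddCommGroup C] [TopologicalSpace C]

/-- The projection to a quotient group. -/
def quotientMk [IsTopologicalAddGroup B] (N : AddSubgroup B) : B →ₜ+ B ⧸ N :=
  ⟨QuotientAddGroup.mk' N, QuotientAddGroup.isOpenQuotientMap_mk.continuous⟩

theorem isShortExact_quotientMk [IsTopologicalAddGroup B] (f : A →ₜ+ B)
    (hf : IsClosedEmbedding f) : IsShortExact f (quotientMk (f : A →+ B).range) where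
  isClosedEmbedding := hf
  exact x := QuotientAddGroup.eq_zero_iff x
  isOpenQuotientMap := QuotientAddGroup.isOpenQuotientMap_mk

variable {f : A →ₜ+ B} {g : B →ₜ+ C}

theorem IsShortExact.apply_apply (h : IsShortExact f g) (a : A) : g (f a) = 0 :=
  (h.exact _).2 ⟨a, rfl⟩

theorem IsShortExact.exists_retraction [IsTopologicalAddGroup B] (h : IsShortExact f g)
    (t : C →ₜ+ B) (ht : ∀ c, g (t c) = c) : ∃ ρ : B →ₜ+ A, ∀ a, ρ (f a) = a := by
  have hex : ∀ x, ∃ a, f a = x - t (g x) := fun x =>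
    (h.exact _).1 (by rw [map_sub, ht, sub_self])
  choose ρ hρ using hex
  have hinj := h.isClosedEmbedding.injective
  refine ⟨⟨AddMonoidHom.mk' ρ fun x y => hinj ?_, ?_⟩, fun a => hinj ?_⟩
  · rw [map_add, hρ, hρ, hρ, map_add, map_add]
    abel
  · refine h.isClosedEmbedding.isInducing.continuous_iff.2 ?_
    refine Continuous.congr ?_ fun x => (hρ x).symm
    exact continuous_id.sub (t.continuous_toFun.comp g.continuous_toFun)
  · exact (hρ _).trans (by rw [h.apply_apply, map_zero, sub_zero])

/-- The element `b - f (ρ b)` depends only on `g b`, so it descends through the quotient map `g` to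
a continuous section, although the set-theoretic section `s` need not be continuous. -/
theorem IsShortExact.exists_continuousAddEquiv_prod [IsTopologicalAddGroup B]
    (h : IsShortExact f g) (ρ : B →ₜ+ A) (hρ : ∀ a, ρ (f a) = a) :
    ∃ e : B ≃ₜ+ A × C, ∀ b, e b = (ρ b, g b) := by
  have hq := h.isOpenQuotientMap
  choose s hs using hq.surjective
  have hwd : ∀ b, s (g b) - f (ρ (s (g b))) = b - f (ρ b) := by
    intro b
    obtain ⟨a, ha⟩ := (h.exact (s (g b) - b)).1 (by rw [map_sub, hs, sub_self])
    have h1 : s (g b) = f a + b := by rw [ha, sub_add_cancel]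
    rw [h1, map_add, hρ, map_add]
    abel
  have hcont : Continuous fun c => s c - f (ρ (s c)) := by
    refine hq.isQuotientMap.continuous_iff.2 ?_
    refine Continuous.congr ?_ fun b => (hwd b).symm
    exact continuous_id.sub (f.continuous_toFun.comp ρ.continuous_toFun)
  exact ⟨{
    toFun := fun b => (ρ b, g b)
    invFun := fun z => f z.1 + (s z.2 - f (ρ (s z.2)))
    left_inv := fun b => by
      change f (ρ b) + (s (g b) - f (ρ (s (g b)))) = b
      rw [hwd]
      abel
    right_inv := fun z => Prod.ext (by simp [hρ]) (by simp [h.apply_apply, hs])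
    map_add' := fun x y => Prod.ext (map_add ρ x y) (map_add g x y)
    continuous_toFun := ρ.continuous_toFun.prodMk g.continuous_toFun
    continuous_invFun := (f.continuous_toFun.comp continuous_fst).add
      (hcont.comp continuous_snd) }, fun _ => rfl⟩

end Splitting

/-! ### Pullbacks of extensions and vanishing of `Ext` -/

section Pullback

variable {A B : Type u} {Q : Type*} {C : Type v} [AddCommGroup A] [TopologicalSpace A]
  [IsTopologicalAddGroup A] [PolishSpace A] [AddCommGroup B] [TopologicalSpace B]
  [IsTopologicalAddGroup B] [PolishSpace B] [AddCommGroup Q] [TopologicalSpace Q] [T2Space Q]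
  [AddCommGroup C] [TopologicalSpace C] [IsTopologicalAddGroup C] [PolishSpace C]

/-- Extensions `A → B → Q` can be pulled back along `r : C → Q`. -/
theorem IsShortExact.exists_pullback {f : A →ₜ+ B} {g : B →ₜ+ Q} (h : IsShortExact f g)
    (r : C →ₜ+ Q) :
    ∃ (E : PolishExtension C A) (q : E.X →ₜ+ B), ∀ x, g (q x) = r (E.proj x) := by
  let P : AddSubgroup (B × C) :=
    ((g : B →+ Q).comp (AddMonoidHom.fst B C)).eqLocus ((r : C →+ Q).comp (AddMonoidHom.snd B C))
  have hP : IsClosed (P : Set (B × C)) :=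
    isClosed_eq (g.continuous_toFun.comp continuous_fst) (r.continuous_toFun.comp continuous_snd)
  have : PolishSpace P := hP.polishSpace
  let i : A →+ P := ((f : A →+ B).prod 0).codRestrict P
    fun a => (h.apply_apply a).trans (map_zero r).symm
  have hi : Continuous i := Continuous.subtype_mk (f.continuous_toFun.prodMk continuous_const) _
  refine ⟨{
    X := P
    incl := ⟨i, hi⟩
    proj := ⟨(AddMonoidHom.snd B C).comp P.subtype, continuous_snd.comp continuous_subtype_val⟩
    isShortExact :=
      -- Following `i` by the first projection gives `f`, so `i` is inducing; completeness of `A`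
      -- makes its image closed.
      { isClosedEmbedding := isClosedEmbedding_of_isInducing i
          (IsInducing.of_comp hi (continuous_fst.comp continuous_subtype_val)
            h.isClosedEmbedding.isInducing)
        exact := by
          rintro ⟨⟨b, c⟩, hbc⟩
          constructor
          · intro hc
            obtain rfl : c = 0 := hc
            obtain ⟨a, ha⟩ := (h.exact b).1 (hbc.trans (map_zero r))
            exact ⟨a, Subtype.ext (Prod.ext ha rfl)⟩
          · rintro ⟨a, ha⟩
            exact (congrArg (fun z : P => z.1.2) ha).symm
        isOpenQuotientMap := by
          refine ⟨fun c => ?_, continuous_snd.comp continuous_subtype_val, ?_⟩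
          · obtain ⟨b, hb⟩ := h.isOpenQuotientMap.surjective (r c)
            exact ⟨⟨(b, c), hb⟩, rfl⟩
          · refine IsOpenMap.of_nhds_le ?_
            rintro ⟨⟨b, c⟩, hbc⟩ s hs
            have hs' : (fun z : P => z.1.2) ⁻¹' s ∈ 𝓝 (⟨(b, c), hbc⟩ : P) := hs
            rw [nhds_subtype, mem_comap, nhds_prod_eq] at hs'
            obtain ⟨T, hT, hTs⟩ := hs'
            obtain ⟨U, hU, V, hV, hUV⟩ := mem_prod_iff.1 hT
            have hgU : g '' U ∈ 𝓝 (r c) := by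
              have hbc' : g b = r c := hbc
              rw [← hbc']
              exact h.isOpenQuotientMap.isOpenMap.image_mem_nhds hU
            filter_upwards [hV, r.continuous_toFun.continuousAt.preimage_mem_nhds hgU]
              with d hd hd'
            obtain ⟨x, hx, hxd⟩ := hd'
            exact hTs (show (⟨(x, d), hxd⟩ : P) ∈ Subtype.val ⁻¹' T from
              hUV (Set.mk_mem_prod hx hd)) } },
    ⟨(AddMonoidHom.fst B C).comp P.subtype, continuous_fst.comp continuous_subtype_val⟩,
    fun x => x.2⟩

/-- If `Ext(C, A)` vanishes, the maps `C → Q` lift along `B → Q`. -/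
theorem IsShortExact.exists_lift_of_ext_eq_zero {f : A →ₜ+ B} {g : B →ₜ+ Q}
    (h : IsShortExact f g) (hExt : ∀ e : Ext C A, e = 0) (r : C →ₜ+ Q) :
    ∃ t : C →ₜ+ B, ∀ c, g (t c) = r c := by
  obtain ⟨E, q, hq⟩ := h.exists_pullback r
  obtain ⟨e, -, he⟩ : PolishExtension.Iso E (PolishExtension.split C A) :=
    Quotient.exact (hExt (Quotient.mk _ E))
  let e' : E.X ≃ₜ+ A × C := e
  refine ⟨⟨(q : E.X →+ B).comp ((e'.symm : (A × C) →+ E.X).comp (AddMonoidHom.inr A C)),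
    q.continuous_toFun.comp (e'.symm.continuous.comp (Continuous.prodMk_right (0 : A)))⟩,
    fun c => (hq _).trans (congrArg r ?_)⟩
  refine (he (e'.symm (0, c))).symm.trans ?_
  exact congrArg Prod.snd (e'.apply_symm_apply (0, c))

end Pullback

theorem ext_eq_zero_of_retraction {C : Type v} {A : Type u} [AddCommGroup C] [TopologicalSpace C]
    [AddCommGroup A] [TopologicalSpace A] [IsTopologicalAddGroup C] [PolishSpace C]
    [IsTopologicalAddGroup A] [PolishSpace A]
    (h : ∀ E : PolishExtension C A, ∃ ρ : E.X →ₜ+ A, ∀ a, ρ (E.incl a) = a) (e : Ext C A) :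
    e = 0 := by
  induction e using Quotient.inductionOn with
  | h E =>
    obtain ⟨ρ, hρ⟩ := h E
    obtain ⟨e, he⟩ := E.isShortExact.exists_continuousAddEquiv_prod ρ hρ
    refine Quotient.sound ⟨e, fun a => ?_, fun x => ?_⟩
    · exact (he _).trans (Prod.ext (hρ a) (E.isShortExact.apply_apply a))
    · exact congrArg Prod.snd (he x)


/-! ### The theorem -/

section Main

variable {p : ℕ} {G : Type u} [AddCommGroup G] [TopologicalSpace G]
  [IsTopologicalAddGroup G] [PolishSpace G]

/-- Divisible pro-`p` groups with a basis of divisible zero neighbourhoods are injective relative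
to extensions of nonarchimedean groups. -/
theorem HasOpenPBasis.exists_extension (hp : HasOpenPBasis p G) (hd : IsDivisible G)
    (hb : HasDivisibleBasis G) {A B C : Type*} [AddCommGroup A] [TopologicalSpace A]
    [AddCommGroup B] [TopologicalSpace B] [IsTopologicalAddGroup B] [AddCommGroup C]
    [TopologicalSpace C] [NonarchimedeanAddGroup C] {f : A →ₜ+ B} {g : B →ₜ+ C}
    (h : IsShortExact f g) (φ : A →ₜ+ G) : ∃ ψ : B →ₜ+ G, ∀ a, ψ (f a) = φ a := by
  obtain ⟨D, _, _, _, _, hD, -, ⟨e⟩⟩ := exists_continuousAddEquiv_pi_discrete hp hd hb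
  exact h.exists_extension_pi hD e φ

theorem hasOpenPBasis_power (p : ℕ) : HasOpenPBasis p (ℕ → PruferSum p) :=
  hasOpenPBasis_pi fun _ => PruferSum.isPTorsion p

theorem hasOpenPBasis_ulift (p : ℕ) : HasOpenPBasis p (ULift.{u} (ℕ → PruferSum p)) :=
  (hasOpenPBasis_power p).of_isOpenQuotientMap (uliftUpHom _) (isOpenQuotientMap_uliftUpHom _)

theorem isDivisible_ulift (p : ℕ) [Fact p.Prime] : IsDivisible (ULift.{u} (ℕ → PruferSum p)) :=
  (IsDivisible.pi fun _ => PruferSum.isDivisible p).of_surjective (uliftUpHom _)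
    (isOpenQuotientMap_uliftUpHom _).surjective

theorem hasDivisibleBasis_ulift (p : ℕ) [Fact p.Prime] :
    HasDivisibleBasis (ULift.{u} (ℕ → PruferSum p)) :=
  (hasDivisibleBasis_pi fun _ => PruferSum.isDivisible p).of_isOpenQuotientMap (uliftUpHom _)
    (isOpenQuotientMap_uliftUpHom _)

theorem isDivisible_and_hasDivisibleBasis_of_retraction {p : ℕ} [Fact p.Prime] {G : Type*}
    [AddCommGroup G] [TopologicalSpace G]
    (i : G →ₜ+ ULift.{u} (ℕ → PruferSum p)) (r : ULift.{u} (ℕ → PruferSum p) →ₜ+ G)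
    (hri : ∀ x, r (i x) = x) : IsDivisible G ∧ HasDivisibleBasis G :=
  ⟨(isDivisible_ulift p).of_surjective (r : ULift.{u} (ℕ → PruferSum p) →+ G)
    fun x => ⟨i x, hri x⟩, (hasDivisibleBasis_ulift p).of_retraction r i hri⟩

variable [Fact p.Prime]

theorem HasOpenPBasis.exists_isClosedEmbedding_ulift (h : HasOpenPBasis p G) :
    ∃ f : G →ₜ+ ULift.{u} (ℕ → PruferSum p), IsClosedEmbedding f := by
  obtain ⟨f, hf⟩ := h.exists_isClosedEmbedding
  exact ⟨⟨(uliftUpHom _).comp (f : G →+ ℕ → PruferSum p), continuous_uliftUp.comp f.continuous_toFun⟩,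
    (Homeomorph.ulift.symm.isClosedEmbedding (X := ℕ → PruferSum p)).comp hf⟩

theorem HasOpenPBasis.of_isInjectiveInPAb (hp : HasOpenPBasis p G)
    (h : IsInjectiveInPAb p G) : IsDivisible G ∧ HasDivisibleBasis G := by
  obtain ⟨f, hf⟩ := hp.exists_isClosedEmbedding_ulift
  have hex := isShortExact_quotientMk f hf
  have := polishSpace_quotient (f : G →+ ULift.{u} (ℕ → PruferSum p)).range hf.isClosed_range
  have hQ := (hasOpenPBasis_ulift.{u} p).of_isOpenQuotientMap _ hex.isOpenQuotientMap
  obtain ⟨ψ, hψ⟩ := h G _ _ hp.isProP (hasOpenPBasis_ulift p).isProP hQ.isProP _ _ hex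
    (ContinuousAddMonoidHom.id G)
  exact isDivisible_and_hasDivisibleBasis_of_retraction f ψ fun x => DFunLike.congr_fun hψ x

/-- The hypothesis concerns the full Prüfer power rather than `Q`. The quotient `Q` is already known
to be injective, hence a retract `r ∘ s = id` of that power; a lift `t` of `r` gives the section `t
∘ s` of the quotient map. -/
theorem HasOpenPBasis.of_ext_eq_zero (hp : HasOpenPBasis p G)
    (h : ∀ e : Ext (ℕ → PruferSum p) G, e = 0) : IsDivisible G ∧ HasDivisibleBasis G := by
  obtain ⟨f, hf⟩ := hp.exists_isClosedEmbedding_ulift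
  have hex := isShortExact_quotientMk f hf
  let Q := ULift.{u} (ℕ → PruferSum p) ⧸ (f : G →+ ULift.{u} (ℕ → PruferSum p)).range
  have : PolishSpace Q := polishSpace_quotient _ hf.isClosed_range
  have hQ : HasOpenPBasis p Q :=
    (hasOpenPBasis_ulift.{u} p).of_isOpenQuotientMap _ hex.isOpenQuotientMap
  have hQd : IsDivisible Q :=
    (isDivisible_ulift p).of_surjective _ hex.isOpenQuotientMap.surjective
  have hQb : HasDivisibleBasis Q :=
    (hasDivisibleBasis_ulift p).of_isOpenQuotientMap _ hex.isOpenQuotientMap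
  obtain ⟨s, hs⟩ := hQ.exists_isClosedEmbedding
  have hexs := isShortExact_quotientMk s hs
  have := ((hasOpenPBasis_power p).of_isOpenQuotientMap _
    hexs.isOpenQuotientMap).nonarchimedeanAddGroup
  obtain ⟨r, hr⟩ := hQ.exists_extension hQd hQb hexs (ContinuousAddMonoidHom.id Q)
  obtain ⟨t, ht⟩ := hex.exists_lift_of_ext_eq_zero h r
  obtain ⟨ρ, hρ⟩ := hex.exists_retraction (t.comp s) fun c => (ht (s c)).trans (hr c)
  exact isDivisible_and_hasDivisibleBasis_of_retraction f ρ hρ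

end Main

end ProPPolish

open ProPPolish in
theorem mainTheorem5 (p : ℕ) [Fact p.Prime] (G : Type u) [AddCommGroup G] [TopologicalSpace G]
    [IsTopologicalAddGroup G] [PolishSpace G] (hG : IsProP p G) :
    List.TFAE [
      IsInjectiveInPAb p G,
      Nonempty (DivisibleBy G ℕ) ∧
        (𝓝 (0 : G)).HasBasis
          (fun V : AddSubgroup G => (V : Set G) ∈ 𝓝 (0 : G) ∧ Nonempty (DivisibleBy V ℕ))
          (fun V => (V : Set G)),
      ∃ α β : ℕ∞, Nonempty (G ≃ₜ+ ((Below α → Prufer p) × (Below β → PruferSum p))),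
      ∀ e : Ext (ℕ → PruferSum p) G, e = 0] := by
  have hprime : p.Prime := Fact.out
  have hp := hG.hasOpenPBasis hprime
  rw [nonempty_divisibleBy_iff, hasBasis_divisible_iff]
  tfae_have 1 → 2 := hp.of_isInjectiveInPAb
  tfae_have 4 → 2 := hp.of_ext_eq_zero
  tfae_have 2 → 1 := by
    rintro ⟨hd, hb⟩ A B C _ _ _ _ _ _ _ _ _ _ _ _ - - hC f g hex φ
    have := (hC.hasOpenPBasis hprime).nonarchimedeanAddGroup
    obtain ⟨ψ, hψ⟩ := hp.exists_extension hd hb hex φ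
    exact ⟨ψ, DFunLike.ext _ _ hψ⟩
  tfae_have 2 → 4 := by
    rintro ⟨hd, hb⟩
    have := (hasOpenPBasis_power p).nonarchimedeanAddGroup
    exact ext_eq_zero_of_retraction fun E =>
      hp.exists_extension hd hb E.isShortExact (ContinuousAddMonoidHom.id G)
  tfae_have 2 → 3 := by
    rintro ⟨hd, hb⟩
    obtain ⟨D, _, _, _, _, hD, hDp, ⟨e⟩⟩ := exists_continuousAddEquiv_pi_discrete hp hd hb
    obtain ⟨α, β, ⟨e'⟩⟩ := exists_continuousAddEquiv_prufer D hD hDp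
    exact ⟨α, β, ⟨e.trans e'⟩⟩
  tfae_have 3 → 2 := by
    rintro ⟨α, β, ⟨e⟩⟩
    have hP := Prufer.isDivisible p
    have hS := PruferSum.isDivisible p
    exact ⟨((IsDivisible.pi fun _ => hP).prod (IsDivisible.pi fun _ => hS)).of_surjective
        e.symm.toAddEquiv.toAddMonoidHom e.symm.surjective,
      ((hasDivisibleBasis_pi fun _ => hP).prod (hasDivisibleBasis_pi fun _ => hS)).of_retraction
        ⟨e.symm.toAddEquiv.toAddMonoidHom, e.symm.continuous⟩
        ⟨e.toAddEquiv.toAddMonoidHom, e.continuous⟩ e.symm_apply_apply⟩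
  tfae_finish
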